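/- **Setting.** Let $K\ge 1$ and let $F_1,\dots,F_K:[0,1]\to[0,1]$ be non-decreasing. Let $\Delta_K=\{x\in[0,1]^K:\sum_k x_k=1\}$ and $F(x)=(F_1(x_1),\dots,F_K(x_K))$. At each time $t$ there are rewards $G_t=(G_{t,1},\dots,G_{t,K})\in[0,1]^K$ and completion processes $B_{t,k}(x)\in\{0,1\}$, $x\in[0,1]$, with $\mathbb E[B_{t,k}(x)]=F_k(x)$. For each $k$ the variables $(G_{t,k})_t$ are identically distributed with mean $\mu_k$. The reward vectors $(G_t)_t$ and the completion processes $(B_t)_t$ are independent over time and of each other, and each $B_t$ is a measurable function of the budget and of the noise of round $t$ (tasks may be dependent within a round). If the learner plays $X_1,X_2,\dots\in\Delta_K$, write $N_{t,k}=\sum_{s=1}^t B_{s,k}(X_{s,k})$ and, with $0/0=0$, $$\mathrm{UCB}^\delta_{t,k}=\frac{\sum_{s=1}^t B_{s,k}(X_{s,k})G_{s,k}}{N_{t,k}}+\sqrt{\frac{\log(2/\delta)}{1+N_{t,k}}},\qquad t\ge 0 .$$ The UCB algorithm with horizon $T$ and parameter $\delta$ plays, at each time $t=1,\dots,T$, an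 allocation $X_t\in\Delta_K$, chosen from the feedback $\bigl(B_{s,k}(X_{s,k}),\,B_{s,k}(X_{s,k})G_{s,k}\bigr)_{s<t,\,k\le K}$, that maximizes $x\mapsto\langle \mathrm{UCB}^\delta_{t-1},F(x)\rangle$ over $\Delta_K$. **Assumptions.** Each $F_k$ is continuously differentiable on $(0,1]$ with $\lim_{u\to0^+}F_k'(u)=+\infty$. There are functions $\alpha,M:(0,1]\to(0,\infty)$ such that for all $k$ and $\epsilon\in(0,1]$ the function $F_k$ is $\alpha(\epsilon)$-strongly concave and $M(\epsilon)$-Lipschitz on $[\epsilon,1]$ (at $\epsilon=1$ this is no condition). All $\mu_k$ lie in $(0,1]$. **Notation.** Let $D_{\min}(\epsilon)=\min_k\inf_{u\in(0,\epsilon]}F_k'(u)$, $D_{\max}(\epsilon)=\max_k\sup_{u\in[\epsilon,1]}F_k'(u)$, $D_{\min}^{-1}(y)=\inf\{\epsilon\in(0,1]:D_{\min}(\epsilon)\le y\}$, $\mu_{\inf}=\min_k\mu_k$, $u_{\inf}=D_{\min}^{-1}\bigl(\tfrac{2}{\mu_{\inf}}D_{\max}(\tfrac1K)\bigr)$ and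 $v_{\inf}=D_{\min}^{-1}\bigl(\tfrac{2}{\mu_{\inf}}D_{\max}(\tfrac1{K^2})\bigr)$. For $\delta\in(0,1)$, $T\in\mathbb N$ and $c>0$ put $$\mathcal B_{T}(\delta,c)=\frac{32\,M(u_{\inf})^2\log(\frac2\delta)\,K}{\mu_{\inf}\,\alpha(u_{\inf})\,\min_kF_k(u_{\inf})}\log T+cK^2+\frac{4K^2\bigl(100(\log T)^2+1\bigr)}{\min_kF_k(v_{\inf})}.$$ **Theorem.** Let $T\ge3$. Then $\langle\mu,F(\cdot)\rangle$ attains its maximum over $\Delta_K$, and for any maximizer $x^\star$, with the realized regret $\mathcal R_T=\sum_{t=1}^T\sum_{k=1}^K\bigl(\mu_kF_k(x^\star_k)-\mu_kF_k(X_{t,k})\bigr)$: 1. For every $\delta\in\bigl(2e^{-50(\log T)^2},1\bigr)$, if the UCB algorithm is run with parameters $T$ and $\delta$, then $$\mathbb P\bigl[\mathcal R_T\le\mathcal B_T(\delta,3)\bigr]\ \ge\ 1-\frac KT-KT\delta .$$ 2. If the UCB algorithm is run with parameters $T$ and $\delta=\frac1{(KT)^2}$, then the regret $R_T=T\sup_{x\in\Delta_K}\langle\mu,F(x)\rangle-\sum_{t=1}^T\mathbb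 E[\langle\mu,F(X_t)\rangle]$ satisfies $R_T=\mathbb E[\mathcal R_T]$ and $$R_T\le\mathcal B_T\Bigl(\frac1{(KT)^2},\,5\Bigr).$$ -/

import Mathlib

open MeasureTheory ProbabilityTheory Set Filter Topology
open scoped NNReal

noncomputable section

namespace BudgetBandit

/-- The reward function `⟨m, F x⟩ = ∑ k, m k * F k (x k)`. -/
def reward {K : ℕ} (F : Fin K → ℝ → ℝ) (m x : Fin K → ℝ) : ℝ :=
  ∑ k, m k * F k (x k)

/-- `x` is a maximizer of `⟨m, F ·⟩` over the probability simplex. -/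
def IsOptimal {K : ℕ} (F : Fin K → ℝ → ℝ) (m x : Fin K → ℝ) : Prop :=
  x ∈ stdSimplex ℝ (Fin K) ∧ IsMaxOn (reward F m) (stdSimplex ℝ (Fin K)) x

/-- The budget-to-success curves are non-decreasing functions from `[0,1]` to `[0,1]`. -/
structure IsCurveFamily {K : ℕ} (F : Fin K → ℝ → ℝ) : Prop where
  mapsTo : ∀ k, MapsTo (F k) (Icc 0 1) (Icc 0 1)
  monotoneOn : ∀ k, MonotoneOn (F k) (Icc 0 1)

/-- The derivative of `F k` on `(0,1]` (one-sided at the endpoint `1`). -/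
def slope {K : ℕ} (F : Fin K → ℝ → ℝ) (k : Fin K) (u : ℝ) : ℝ :=
  derivWithin (F k) (Ioc 0 1) u

/-- The diminishing-returns assumption: `F k` is continuously differentiable on `(0,1]`, its
derivative tends to `+∞` at `0+`, and it is `α ε`-strongly concave on `[ε,1]`, with `α > 0`.
(At `ε = 1` the interval is a single point and strong concavity is no condition.) -/
structure DiminishingReturns {K : ℕ} (F : Fin K → ℝ → ℝ) (α : ℝ → ℝ) : Prop where
  contDiffOn : ∀ k, ContDiffOn ℝ 1 (F k) (Ioc 0 1)
  tendsto_slope : ∀ k, Tendsto (slope F k) (𝓝[>] 0) atTop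
  alpha_pos : ∀ ε ∈ Ioc (0 : ℝ) 1, 0 < α ε
  strongConcaveOn : ∀ k, ∀ ε ∈ Ioc (0 : ℝ) 1, StrongConcaveOn (Icc ε 1) (α ε) (F k)

/-- `M ε > 0` is a common Lipschitz constant of all `F k` on `[ε,1]`. -/
structure IsLipschitzModulus {K : ℕ} (F : Fin K → ℝ → ℝ) (M : ℝ → ℝ≥0) : Prop where
  pos : ∀ ε ∈ Ioc (0 : ℝ) 1, 0 < M ε
  lipschitzOnWith : ∀ k, ∀ ε ∈ Ioc (0 : ℝ) 1, LipschitzOnWith (M ε) (F k) (Icc ε 1)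

/-- `D_min(ε) = min_k inf_{u ∈ (0,ε]} F_k'(u)`. -/
def Dmin {K : ℕ} (F : Fin K → ℝ → ℝ) (ε : ℝ) : ℝ :=
  ⨅ k, sInf (slope F k '' Ioc 0 ε)

/-- `D_max(ε) = max_k sup_{u ∈ [ε,1]} F_k'(u)`. -/
def Dmax {K : ℕ} (F : Fin K → ℝ → ℝ) (ε : ℝ) : ℝ :=
  ⨆ k, sSup (slope F k '' Icc ε 1)

/-- `D_min⁻¹(y) = inf {ε ∈ (0,1] : D_min(ε) ≤ y}`. -/
def DminInv {K : ℕ} (F : Fin K → ℝ → ℝ) (y : ℝ) : ℝ :=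
  sInf {ε | ε ∈ Ioc (0 : ℝ) 1 ∧ Dmin F ε ≤ y}

/-- `μ_inf = min_k μ_k`. -/
def muInf {K : ℕ} (μ : Fin K → ℝ) : ℝ := ⨅ k, μ k

/-- `D_min⁻¹((2 / μ_inf) D_max(v))`; the value at `v = 1/K` is `u_inf`. -/
def budgetFloor {K : ℕ} (F : Fin K → ℝ → ℝ) (μ : Fin K → ℝ) (v : ℝ) : ℝ :=
  DminInv F (2 / muInf μ * Dmax F v)

/-- `u_inf = D_min⁻¹((2 / μ_inf) D_max(1/K))`. -/
def uInf {K : ℕ} (F : Fin K → ℝ → ℝ) (μ : Fin K → ℝ) : ℝ :=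
  budgetFloor F μ (1 / (K : ℝ))

/-- The right-hand side of the regret bounds, in which the coefficient of `K²` is `c`. -/
def regretBound {K : ℕ} (F : Fin K → ℝ → ℝ) (α : ℝ → ℝ) (M : ℝ → ℝ≥0) (μ : Fin K → ℝ)
    (T : ℕ) (δ c : ℝ) : ℝ :=
  32 * (M (uInf F μ) : ℝ) ^ 2 * Real.log (2 / δ) * K /
      (muInf μ * α (uInf F μ) * ⨅ k, F k (uInf F μ)) * Real.log T
    + c * (K : ℝ) ^ 2
    + 4 * (K : ℝ) ^ 2 * (100 * Real.log T ^ 2 + 1) /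
      ⨅ k, F k (budgetFloor F μ (1 / (K : ℝ) ^ 2))

/-- The stochastic environment with success curves `F` and mean rewards `μ`.
`G t ω k` is the reward of task `k` at time `t`; `B t k x ω ∈ {0,1}` indicates whether task `k`
is completed at time `t` when its budget is `x`. The reward vectors `G t` and the completion
processes `B t` are independent over time and of each other (tasks may be dependent within a
round). The completion process of round `t` is a measurable function of the budget and of the
randomness `noise t` of that round, so that it can be evaluated at a random budget. -/
structure Environment {Ω : Type*} [mΩ : MeasurableSpace Ω] (P : Measure Ω) {K : ℕ}
    (F : Fin K → ℝ → ℝ) (μ : Fin K → ℝ) where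
  G : ℕ → Ω → Fin K → ℝ
  B : ℕ → Fin K → ℝ → Ω → ℝ
  noise : ℕ → MeasurableSpace Ω
  measurable_G : ∀ t, Measurable (G t)
  G_mem : ∀ t ω k, G t ω k ∈ Icc (0 : ℝ) 1
  G_identDistrib : ∀ s t k, IdentDistrib (fun ω => G s ω k) (fun ω => G t ω k) P P
  G_mean : ∀ t k, ∫ ω, G t ω k ∂P = μ k
  noise_le : ∀ t, noise t ≤ mΩ
  B_eq_zero_or_one : ∀ t k x ω, B t k x ω = 0 ∨ B t k x ω = 1
  measurable_B : ∀ t k, Measurable[MeasurableSpace.prod inferInstance (noise t)]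
    (fun p : ℝ × Ω => B t k p.1 p.2)
  B_mean : ∀ t k, ∀ x ∈ Icc (0 : ℝ) 1, ∫ ω, B t k x ω ∂P = F k x
  indep : iIndep (Sum.elim noise
    (fun t => MeasurableSpace.comap (G t) inferInstance)) P

namespace Environment

variable {Ω : Type*} [MeasurableSpace Ω] {P : Measure Ω} {K : ℕ}
  {F : Fin K → ℝ → ℝ} {μ : Fin K → ℝ}

/-- `B_{t,k}(X_{t,k})`: completion of task `k` at time `t` under the played allocation. -/
def done (E : Environment P F μ) (X : ℕ → Ω → Fin K → ℝ) (t : ℕ) (k : Fin K) (ω : Ω) : ℝ :=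
  E.B t k (X t ω k) ω

/-- `B_{t,k}(X_{t,k}) G_{t,k}`: the censored reward observed by the learner. -/
def gain (E : Environment P F μ) (X : ℕ → Ω → Fin K → ℝ) (t : ℕ) (k : Fin K) (ω : Ω) : ℝ :=
  E.done X t k ω * E.G t ω k

/-- The `σ`-algebra of the censored feedback of rounds `1, …, t`. -/
@[reducible]
def history (E : Environment P F μ) (X : ℕ → Ω → Fin K → ℝ) (t : ℕ) : MeasurableSpace Ω :=
  ⨆ s ∈ Finset.Icc 1 t, ⨆ k,
    MeasurableSpace.comap (E.done X s k) inferInstance ⊔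
      MeasurableSpace.comap (E.gain X s k) inferInstance

/-- The upper confidence bounds after round `t` (with `0 / 0 = 0`, and so equal to
`√(log (2/δ))` for a task that has not been completed yet). -/
def ucb (E : Environment P F μ) (X : ℕ → Ω → Fin K → ℝ) (δ : ℝ) (t : ℕ) (ω : Ω)
    (k : Fin K) : ℝ :=
  (∑ s ∈ Finset.Icc 1 t, E.gain X s k ω) / (∑ s ∈ Finset.Icc 1 t, E.done X s k ω)
    + √(Real.log (2 / δ) / (1 + ∑ s ∈ Finset.Icc 1 t, E.done X s k ω))

/-- `X 1, …, X T` are the allocations played by the UCB algorithm with parameters `T` and `δ`: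
each is chosen from the feedback of the past rounds and maximizes the optimistic reward. -/
structure IsUCBRun (E : Environment P F μ) (T : ℕ) (δ : ℝ) (X : ℕ → Ω → Fin K → ℝ) :
    Prop where
  adapted : ∀ t < T, Measurable[E.history X t] (X (t + 1))
  isOptimal : ∀ t < T, ∀ ω, IsOptimal F (E.ucb X δ t ω) (X (t + 1) ω)

end Environment

/-- The realized regret, against the allocation `xs`. -/
def realizedRegret {Ω : Type*} {K : ℕ} (F : Fin K → ℝ → ℝ) (μ : Fin K → ℝ)
    (X : ℕ → Ω → Fin K → ℝ) (T : ℕ) (xs : Fin K → ℝ) (ω : Ω) : ℝ :=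
  ∑ t ∈ Finset.Icc 1 T, ∑ k, (μ k * F k (xs k) - μ k * F k (X t ω k))

/-- The (expected) regret `R_T = T sup_x ⟨μ, F x⟩ - ∑_t E⟨μ, F (X_t)⟩`. -/
def regret {Ω : Type*} [MeasurableSpace Ω] (P : Measure Ω) {K : ℕ} (F : Fin K → ℝ → ℝ)
    (μ : Fin K → ℝ) (X : ℕ → Ω → Fin K → ℝ) (T : ℕ) : ℝ :=
  T * sSup (reward F μ '' stdSimplex ℝ (Fin K))
    - ∑ t ∈ Finset.Icc 1 T, ∫ ω, reward F μ (X t ω) ∂P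

end BudgetBandit

end

/-! The regret per round is quadratic, not linear, in the confidence widths. If `x` is optimal for
weights `m` and `xs` for `μ`, comparing `x` with the midpoint of `x` and `xs` yields, by strong
concavity, a gain that absorbs the squared distance between them. Completing the square leaves a
multiple of the squared errors of `m` (`IsOptimal.sum_sub_le`). Squared widths are of order `1 / (1
+ N)`, and when the counts `N` grow linearly they sum to a logarithm.

Linear growth and uniform moduli both require budgets bounded away from zero. This follows from an
exchange argument (`IsOptimal.mul_Dmin_le`, `IsOptimal.budgetFloor_le`): slopes explode at `0`, so
an optimal allocation starves no task, provided some well-funded task has weight at most `2`. An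
upper confidence bound is at most `2` once its task has been completed often enough. In a round
where some task still has low expected count, at least one such task receives `uInf`, so the total
progress of low tasks bounds the number of these rounds; each costs at most `K`. `sum_regret_le`
combines the two kinds of rounds deterministically.

Two events of high probability feed it, both proved by exponential supermartingales
(`measureReal_le_sum_le`) and union bounds: validity of the confidence intervals (Hoeffding's lemma
for the rewards of the first `n` completions) and counts at least half of their predictable sums (a
Chernoff bound). In expectation, the bad event contributes at most `1 + K ^ 2` when `K < T`; for `K
≥ T` the trivial bound `K * T` suffices. -/

namespace BudgetBandit

/-! ### Slopes, the budget floor and the exchange argument -/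

section Curves

variable {K : ℕ} {F : Fin K → ℝ → ℝ} {α : ℝ → ℝ} {μ : Fin K → ℝ}

theorem slope_nonneg (hF : IsCurveFamily F) (k : Fin K) (u : ℝ) : 0 ≤ slope F k u :=
  ((hF.monotoneOn k).mono Ioc_subset_Icc_self).derivWithin_nonneg

theorem DiminishingReturns.continuousOn_slope (hα : DiminishingReturns F α) (k : Fin K) :
    ContinuousOn (slope F k) (Ioc 0 1) :=
  (hα.contDiffOn k).continuousOn_derivWithin (uniqueDiffOn_Ioc 0 1) le_rfl

theorem DiminishingReturns.hasDerivWithinAt (hα : DiminishingReturns F α) (k : Fin K) {u : ℝ}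
    (hu : u ∈ Ioc (0 : ℝ) 1) : HasDerivWithinAt (F k) (slope F k u) (Ioc 0 1) u :=
  ((hα.contDiffOn k).differentiableOn one_ne_zero u hu).hasDerivWithinAt

theorem Dmin_le_slope (hF : IsCurveFamily F) (k : Fin K) {ε u : ℝ} (hu : u ∈ Ioc 0 ε) :
    Dmin F ε ≤ slope F k u := by
  have h0 : ∀ k, BddBelow (slope F k '' Ioc 0 ε) := fun k =>
    ⟨0, by rintro _ ⟨w, -, rfl⟩; exact slope_nonneg hF k w⟩
  exact (ciInf_le (Finite.bddBelow_range _) k).trans (csInf_le (h0 k) (mem_image_of_mem _ hu))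

theorem slope_le_Dmax (hα : DiminishingReturns F α) (k : Fin K) {ε u : ℝ} (hε : 0 < ε)
    (hu : u ∈ Icc ε 1) : slope F k u ≤ Dmax F ε := by
  have hb : BddAbove (slope F k '' Icc ε 1) :=
    isCompact_Icc.bddAbove_image ((hα.continuousOn_slope k).mono
      fun w hw => ⟨hε.trans_le hw.1, hw.2⟩)
  exact (le_csSup hb (mem_image_of_mem _ hu)).trans
    (le_ciSup (f := fun k => sSup (slope F k '' Icc ε 1)) (Finite.bddAbove_range _) k)

theorem Dmin_le_Dmax (hF : IsCurveFamily F) (hα : DiminishingReturns F α) (hK : 1 ≤ K) {ε : ℝ}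
    (hε : ε ∈ Ioc (0 : ℝ) 1) : Dmin F ε ≤ Dmax F ε :=
  (Dmin_le_slope hF ⟨0, hK⟩ ⟨hε.1, le_rfl⟩).trans (slope_le_Dmax hα _ hε.1 ⟨le_rfl, hε.2⟩)

theorem Dmin_nonneg (hF : IsCurveFamily F) (ε : ℝ) : 0 ≤ Dmin F ε :=
  Real.iInf_nonneg fun k => Real.sInf_nonneg (by rintro _ ⟨w, -, rfl⟩; exact slope_nonneg hF k w)

theorem Dmax_nonneg (hF : IsCurveFamily F) (ε : ℝ) : 0 ≤ Dmax F ε :=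
  Real.iSup_nonneg fun k => Real.sSup_nonneg (by rintro _ ⟨w, -, rfl⟩; exact slope_nonneg hF k w)

theorem Dmax_anti (hα : DiminishingReturns F α) (hK : 1 ≤ K) {ε ε' : ℝ} (hε : 0 < ε)
    (h : ε ≤ ε') (hε' : ε' ≤ 1) : Dmax F ε' ≤ Dmax F ε := by
  have : Nonempty (Fin K) := ⟨⟨0, hK⟩⟩
  refine ciSup_le fun k => csSup_le ((nonempty_Icc.2 hε').image _) ?_
  rintro _ ⟨w, hw, rfl⟩
  exact slope_le_Dmax hα k hε ⟨h.trans hw.1, hw.2⟩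

/-- Infinite slope at `0+` keeps the infimum defining `DminInv` away from `0`. -/
theorem exists_pos_lt_Dmin (hα : DiminishingReturns F α) (hK : 1 ≤ K) (y : ℝ) :
    ∃ ε₀ > 0, ∀ ε, 0 < ε → Dmin F ε ≤ y → ε₀ ≤ ε := by
  have : Nonempty (Fin K) := ⟨⟨0, hK⟩⟩
  have h : ∀ᶠ u in 𝓝[>] (0 : ℝ), ∀ k, y + 1 ≤ slope F k u :=
    eventually_all.2 fun k => (hα.tendsto_slope k).eventually_ge_atTop (y + 1)
  obtain ⟨ε₀, h0, hs⟩ := (mem_nhdsGT_iff_exists_Ioo_subset).1 h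
  refine ⟨ε₀, h0, fun ε hε hy => ?_⟩
  by_contra! hlt
  have : y + 1 ≤ Dmin F ε := by
    refine le_ciInf fun k => le_csInf ((nonempty_Ioc.2 hε).image _) ?_
    rintro _ ⟨w, hw, rfl⟩
    exact hs ⟨hw.1, hw.2.trans_lt hlt⟩ k
  linarith

theorem DminInv_le {ε y : ℝ} (hε : ε ∈ Ioc (0 : ℝ) 1) (h : Dmin F ε ≤ y) : DminInv F y ≤ ε :=
  csInf_le ⟨0, fun _ hw => hw.1.1.le⟩ ⟨hε, h⟩

theorem DminInv_pos (hα : DiminishingReturns F α) (hK : 1 ≤ K) {ε y : ℝ}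
    (hε : ε ∈ Ioc (0 : ℝ) 1) (h : Dmin F ε ≤ y) : 0 < DminInv F y := by
  obtain ⟨ε₀, h0, hs⟩ := exists_pos_lt_Dmin hα hK y
  exact h0.trans_le (le_csInf ⟨ε, hε, h⟩ fun w hw => hs w hw.1.1 hw.2)

theorem muInf_le (k : Fin K) : muInf μ ≤ μ k := ciInf_le (Finite.bddBelow_range _) k

theorem muInf_mem (hK : 1 ≤ K) (hμ : ∀ k, μ k ∈ Ioc (0 : ℝ) 1) : muInf μ ∈ Ioc (0 : ℝ) 1 := by
  have : Nonempty (Fin K) := ⟨⟨0, hK⟩⟩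
  obtain ⟨k, hk⟩ := exists_eq_ciInf_of_finite (f := μ)
  rw [muInf, ← hk]; exact hμ k

theorem Dmin_le_two_div_mul_Dmax (hF : IsCurveFamily F) (hα : DiminishingReturns F α)
    (hK : 1 ≤ K) (hμ : ∀ k, μ k ∈ Ioc (0 : ℝ) 1) {v : ℝ} (hv : v ∈ Ioc (0 : ℝ) 1) :
    Dmin F v ≤ 2 / muInf μ * Dmax F v := by
  have hm := muInf_mem hK hμ
  have h2 : 1 ≤ 2 / muInf μ := by
    rw [le_div_iff₀ hm.1]; linarith [hm.2]
  exact (Dmin_le_Dmax hF hα hK hv).trans (le_mul_of_one_le_left (Dmax_nonneg hF v) h2)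

theorem budgetFloor_le (hF : IsCurveFamily F) (hα : DiminishingReturns F α)
    (hK : 1 ≤ K) (hμ : ∀ k, μ k ∈ Ioc (0 : ℝ) 1) {v : ℝ} (hv : v ∈ Ioc (0 : ℝ) 1) :
    budgetFloor F μ v ≤ v :=
  DminInv_le hv (Dmin_le_two_div_mul_Dmax hF hα hK hμ hv)

theorem budgetFloor_mem (hF : IsCurveFamily F) (hα : DiminishingReturns F α)
    (hK : 1 ≤ K) (hμ : ∀ k, μ k ∈ Ioc (0 : ℝ) 1) {v : ℝ} (hv : v ∈ Ioc (0 : ℝ) 1) :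
    budgetFloor F μ v ∈ Ioc (0 : ℝ) 1 :=
  ⟨DminInv_pos hα hK hv (Dmin_le_two_div_mul_Dmax hF hα hK hμ hv),
    (budgetFloor_le hF hα hK hμ hv).trans hv.2⟩

theorem budgetFloor_mono (hF : IsCurveFamily F) (hα : DiminishingReturns F α)
    (hK : 1 ≤ K) (hμ : ∀ k, μ k ∈ Ioc (0 : ℝ) 1) {v w : ℝ} (hv : 0 < v) (hvw : v ≤ w)
    (hw : w ≤ 1) : budgetFloor F μ v ≤ budgetFloor F μ w := by
  have hwm : w ∈ Ioc (0 : ℝ) 1 := ⟨hv.trans_le hvw, hw⟩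
  refine csInf_le_csInf ⟨0, fun _ hx => hx.1.1.le⟩
    ⟨w, hwm, Dmin_le_two_div_mul_Dmax hF hα hK hμ hwm⟩ fun x hx => ⟨hx.1, hx.2.trans ?_⟩
  have hm := muInf_mem hK hμ
  exact mul_le_mul_of_nonneg_left (Dmax_anti hα hK hv hvw hw) (by have := hm.1; positivity)

/-- Strong concavity between `u / 2` and `u` gives `F k (3u/4) > (F k (u/2) + F k u) / 2`.
Monotonicity replaces the left side by `F k u`, and `F k (u/2) ≥ 0`. -/
theorem curve_pos (hF : IsCurveFamily F) (hα : DiminishingReturns F α) (k : Fin K) {u : ℝ}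
    (hu : u ∈ Ioc (0 : ℝ) 1) : 0 < F k u := by
  have h2 : u / 2 ∈ Ioc (0 : ℝ) 1 := ⟨by linarith [hu.1], by linarith [hu.1, hu.2]⟩
  obtain ⟨-, hsc⟩ := hα.strongConcaveOn k (u / 2) h2
  have hc := @hsc (u / 2) ⟨le_rfl, h2.2⟩ u ⟨by linarith [hu.1], hu.2⟩ (1 / 2) (1 / 2)
    (by norm_num) (by norm_num) (by norm_num)
  have ha := hα.alpha_pos _ h2
  have hm := hF.monotoneOn k (a := 1 / 2 * (u / 2) + 1 / 2 * u) (b := u)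
    ⟨by linarith [hu.1], by linarith [hu.1, hu.2]⟩ ⟨hu.1.le, hu.2⟩ (by linarith [hu.1])
  have h0 := (hF.mapsTo k (x := u / 2) ⟨h2.1.le, h2.2⟩).1
  have hp : 0 < α (u / 2) / 2 * ‖u / 2 - u‖ ^ 2 := by
    have : ‖u / 2 - u‖ ≠ 0 := by rw [norm_ne_zero_iff]; linarith [hu.1]
    positivity
  simp only [smul_eq_mul] at hc
  linarith

/-- The mean value inequality. Since `x = 0` is allowed and the curve may jump there, it is applied
from `x + η`; monotonicity covers the gap and `η` tends to `0`. -/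
theorem mul_Dmin_le_sub (hF : IsCurveFamily F) (hα : DiminishingReturns F α) (k : Fin K)
    {x h ε : ℝ} (hx : 0 ≤ x) (hh : 0 < h) (hε : x + h ≤ ε) (hε1 : ε ≤ 1) :
    h * Dmin F ε ≤ F k (x + h) - F k x := by
  have key : ∀ η ∈ Ioo 0 h, (h - η) * Dmin F ε ≤ F k (x + h) - F k x := by
    intro η hη
    have hsub : Icc (x + η) (x + h) ⊆ Ioc 0 1 := fun w hw =>
      ⟨by linarith [hw.1, hη.1], by linarith [hw.2]⟩
    have hint : ∀ w ∈ interior (Icc (x + η) (x + h)), Ioc (0 : ℝ) 1 ∈ 𝓝 w := by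
      intro w hw
      rw [interior_Icc] at hw
      exact mem_of_superset (Ioo_mem_nhds (a := 0) (b := 1) (by linarith [hw.1, hη.1])
        (by linarith [hw.2])) Ioo_subset_Ioc_self
    have hd := (hα.contDiffOn k).differentiableOn one_ne_zero
    have := (convex_Icc (x + η) (x + h)).mul_sub_le_image_sub_of_le_deriv (f := F k)
      (C := Dmin F ε) ((hα.contDiffOn k).continuousOn.mono hsub)
      (fun w hw => ((hd w (hsub (interior_subset hw))).differentiableAt
        (hint w hw)).differentiableWithinAt)
      (fun w hw => by
        rw [← derivWithin_of_mem_nhds (hint w hw)]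
        rw [interior_Icc] at hw
        exact Dmin_le_slope hF k ⟨by linarith [hw.1, hη.1], by linarith [hw.2]⟩)
      (x + η) ⟨le_rfl, by linarith [hη.2]⟩ (x + h) ⟨by linarith [hη.2], le_rfl⟩
      (by linarith [hη.2])
    have hm := hF.monotoneOn k (a := x) (b := x + η) ⟨hx, by linarith [hη.2]⟩
      ⟨by linarith [hη.1], by linarith [hη.2]⟩ (by linarith [hη.1])
    nlinarith
  have ht : Tendsto (fun η : ℝ => (h - η) * Dmin F ε) (𝓝[>] 0) (𝓝 ((h - 0) * Dmin F ε)) :=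
    (((continuous_const.sub continuous_id).mul continuous_const).tendsto 0).mono_left
      nhdsWithin_le_nhds
  rw [sub_zero] at ht
  refine le_of_tendsto ht ?_
  filter_upwards [Ioo_mem_nhdsGT hh] with η hη using key η hη

theorem stdSimplex_mem_Icc {x : Fin K → ℝ} (hx : x ∈ stdSimplex ℝ (Fin K)) (k : Fin K) :
    x k ∈ Icc (0 : ℝ) 1 :=
  ⟨hx.1 k, hx.2 ▸ Finset.single_le_sum (fun i _ => hx.1 i) (Finset.mem_univ k)⟩

theorem exists_one_div_le (hK : 1 ≤ K) {x : Fin K → ℝ} (hx : x ∈ stdSimplex ℝ (Fin K)) :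
    ∃ j, 1 / (K : ℝ) ≤ x j := by
  have : Nonempty (Fin K) := ⟨⟨0, hK⟩⟩
  have hK0 : (K : ℝ) ≠ 0 := by positivity
  by_contra! h
  have := Finset.sum_lt_sum_of_nonempty (Finset.univ_nonempty (α := Fin K)) fun i _ => h i
  rw [hx.2] at this
  simp [hK0] at this

/-- Moving budget from task `j` to task `k` does not improve on an optimal allocation. -/
theorem IsOptimal.mul_Dmin_le (hF : IsCurveFamily F) (hα : DiminishingReturns F α)
    {m x : Fin K → ℝ} (hx : IsOptimal F m x) {j k : Fin K} (hjk : k ≠ j) (hm : 0 ≤ m k)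
    (hj : 0 < x j) {ε : ℝ} (hk : x k < ε) (hε : ε ≤ 1) :
    m k * Dmin F ε ≤ m j * slope F j (x j) := by
  have hxj : x j ∈ Ioc (0 : ℝ) 1 := ⟨hj, (stdSimplex_mem_Icc hx.1 j).2⟩
  -- Only the left derivative at `x j` is used: budget is taken away from `j`, and `x j` may be the
  -- endpoint `1`.
  have hd := (hα.hasDerivWithinAt j hxj).mono
    (show Ioo 0 (x j) ⊆ Ioc 0 1 from fun w hw => ⟨hw.1, hw.2.le.trans hxj.2⟩)
  rw [hasDerivWithinAt_iff_tendsto_slope' (by simp), nhdsWithin_Ioo_eq_nhdsLT hj] at hd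
  refine ge_of_tendsto (hd.const_mul (m j)) ?_
  have hlt : max 0 (x j - (ε - x k)) < x j := max_lt hj (by linarith)
  filter_upwards [Ioo_mem_nhdsLT hlt] with w hw
  have hw0 : 0 < w := (le_max_left _ _).trans_lt hw.1
  have hw1 : x j - (ε - x k) < w := (le_max_right _ _).trans_lt hw.1
  set h := x j - w with hh
  have hpos : 0 < h := by linarith [hw.2]
  -- The competitor moves `h` from `j` to `k`. Dividing the comparison by `h` leaves a left
  -- difference quotient of `F j`, whose limit is the claim.
  set y : Fin K → ℝ := x + (Pi.single k h - Pi.single j h) with hy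
  have hyk : y k = x k + h := by simp [hy, hjk]
  have hyj : y j = w := by simp [hy, hjk.symm, hh]
  have hyi : ∀ i, i ≠ k → i ≠ j → y i = x i := fun i h1 h2 => by simp [hy, h1, h2]
  have hys : y ∈ stdSimplex ℝ (Fin K) := by
    constructor
    · intro i
      by_cases h1 : i = k
      · rw [h1, hyk]; linarith [hx.1.1 k]
      by_cases h2 : i = j
      · rw [h2, hyj]; exact hw0.le
      rw [hyi i h1 h2]; exact hx.1.1 i
    · simp [hy, Finset.sum_add_distrib, hx.1.2]
  have hle : reward F m y ≤ reward F m x := hx.2 hys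
  have hdiff : reward F m y - reward F m x
      = m k * (F k (x k + h) - F k (x k)) + m j * (F j w - F j (x j)) := by
    unfold reward
    rw [← Finset.sum_sub_distrib, Finset.sum_eq_add k j hjk]
    · rw [hyk, hyj]; ring
    · intro i _ hi; rw [hyi i hi.1 hi.2, sub_self]
    · simp
    · simp
  have hinc := mul_le_mul_of_nonneg_left
    (mul_Dmin_le_sub hF hα k (hx.1.1 k) hpos (by linarith : x k + h ≤ ε) hε) hm
  have hfin : m k * Dmin F ε * h ≤ m j * (F j (x j) - F j w) := by nlinarith
  have hsl : _root_.slope (F j) (x j) w = (F j (x j) - F j w) / h := by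
    rw [slope_comm, slope_def_field]
  rw [hsl, ← mul_div_assoc, le_div_iff₀ hpos]
  exact hfin

/-- If the weights are at least `muInf μ`, and a task with weight at most `2` gets at least `v`,
then every task gets at least `budgetFloor F μ v`. -/
theorem IsOptimal.budgetFloor_le (hF : IsCurveFamily F) (hα : DiminishingReturns F α)
    (hK : 1 ≤ K) (hμ : ∀ k, μ k ∈ Ioc (0 : ℝ) 1) {m x : Fin K → ℝ} (hx : IsOptimal F m x)
    (hm : ∀ k, muInf μ ≤ m k) {v : ℝ} (hv : 0 < v) {j : Fin K} (hj : v ≤ x j) (hmj : m j ≤ 2)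
    (k : Fin K) : budgetFloor F μ v ≤ x k := by
  have hxj := (stdSimplex_mem_Icc hx.1 j).2
  have hv1 : v ∈ Ioc (0 : ℝ) 1 := ⟨hv, hj.trans hxj⟩
  have hmi := muInf_mem hK hμ
  by_contra! hlt
  have hkj : k ≠ j := by
    rintro rfl
    exact absurd (BudgetBandit.budgetFloor_le hF hα hK hμ hv1) (by linarith)
  obtain ⟨ε, hkε, hε⟩ := exists_between hlt
  have hε1 : ε ≤ 1 := hε.le.trans (budgetFloor_mem hF hα hK hμ hv1).2
  have hε0 : 0 < ε := (hx.1.1 k).trans_lt hkε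
  -- `ε` lies below the infimum that defines the floor, so it fails the defining inequality; the
  -- exchange bound at `ε` contradicts this.
  have hD : 2 / muInf μ * Dmax F v < Dmin F ε := by
    by_contra! hle
    exact absurd (DminInv_le ⟨hε0, hε1⟩ hle) (not_le.2 hε)
  have h1 := hx.mul_Dmin_le hF hα hkj (hmi.1.le.trans (hm k)) (hv.trans_le hj) hkε hε1
  have h2 := slope_le_Dmax hα j hv ⟨hj, hxj⟩
  have h3 := slope_nonneg hF j (x j)
  have h4 : muInf μ * Dmin F ε ≤ 2 * Dmax F v :=
    calc muInf μ * Dmin F ε ≤ m k * Dmin F ε :=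
          mul_le_mul_of_nonneg_right (hm k) (Dmin_nonneg hF ε)
      _ ≤ m j * slope F j (x j) := h1
      _ ≤ 2 * Dmax F v := mul_le_mul hmj h2 h3 (by norm_num)
  rw [div_mul_eq_mul_div, div_lt_iff₀ hmi.1] at hD
  linarith

/-! ### Existence of a maximizer when curves may jump at zero -/

/-- The curves, made right-continuous at `0`. -/
noncomputable def rightLimAtZero (F : Fin K → ℝ → ℝ) (k : Fin K) (x : ℝ) : ℝ :=
  if x = 0 then sInf (F k '' Ioc 0 1) else F k x

theorem rightLimAtZero_eqOn (k : Fin K) : EqOn (rightLimAtZero F k) (F k) (Ioc 0 1) :=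
  fun _ hx => if_neg hx.1.ne'

theorem slope_rightLimAtZero (k : Fin K) :
    EqOn (slope (rightLimAtZero F) k) (slope F k) (Ioc 0 1) :=
  fun _ hx => derivWithin_congr (rightLimAtZero_eqOn k) (rightLimAtZero_eqOn k hx)

theorem bddBelow_image_curve (hF : IsCurveFamily F) (k : Fin K) :
    BddBelow (F k '' Ioc 0 1) :=
  ⟨0, by rintro _ ⟨w, hw, rfl⟩; exact (hF.mapsTo k (Ioc_subset_Icc_self hw)).1⟩

theorem le_rightLimAtZero (hF : IsCurveFamily F) (k : Fin K) {x : ℝ} (hx : x ∈ Icc (0 : ℝ) 1) :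
    F k x ≤ rightLimAtZero F k x := by
  unfold rightLimAtZero
  split_ifs with h
  · subst h
    refine le_csInf ((nonempty_Ioc.2 one_pos).image _) ?_
    rintro _ ⟨w, hw, rfl⟩
    exact hF.monotoneOn k hx (Ioc_subset_Icc_self hw) hw.1.le
  · exact le_rfl

theorem IsCurveFamily.rightLimAtZero (hF : IsCurveFamily F) :
    IsCurveFamily (rightLimAtZero F) where
  mapsTo k x hx := by
    refine ⟨(hF.mapsTo k hx).1.trans (le_rightLimAtZero hF k hx), ?_⟩
    unfold BudgetBandit.rightLimAtZero
    split_ifs with h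
    · exact (csInf_le (bddBelow_image_curve hF k)
        (mem_image_of_mem _ (right_mem_Ioc.2 one_pos))).trans
          (hF.mapsTo k (right_mem_Icc.2 zero_le_one)).2
    · exact (hF.mapsTo k hx).2
  monotoneOn k x hx y hy hxy := by
    unfold BudgetBandit.rightLimAtZero
    split_ifs with h1 h2 h2
    · exact le_rfl
    · exact csInf_le (bddBelow_image_curve hF k)
        (mem_image_of_mem _ ⟨lt_of_le_of_ne hy.1 (Ne.symm h2), hy.2⟩)
    · exact absurd (le_antisymm (h2 ▸ hxy) hx.1) h1
    · exact hF.monotoneOn k hx hy hxy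

theorem DiminishingReturns.rightLimAtZero (hα : DiminishingReturns F α) :
    DiminishingReturns (rightLimAtZero F) α where
  contDiffOn k := (hα.contDiffOn k).congr (rightLimAtZero_eqOn k)
  tendsto_slope k := (hα.tendsto_slope k).congr' (by
    filter_upwards [Ioc_mem_nhdsGT one_pos] with x hx using (slope_rightLimAtZero k hx).symm)
  alpha_pos := hα.alpha_pos
  strongConcaveOn k ε hε := by
    have he : EqOn (BudgetBandit.rightLimAtZero F k) (F k) (Icc ε 1) :=
      fun w hw => rightLimAtZero_eqOn k ⟨hε.1.trans_le hw.1, hw.2⟩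
    obtain ⟨hc, hsc⟩ := hα.strongConcaveOn k ε hε
    refine ⟨hc, fun x hx y hy a b ha hb hab => ?_⟩
    rw [he hx, he hy, he (hc hx hy ha hb hab)]
    exact hsc hx hy ha hb hab

theorem continuousOn_rightLimAtZero (hF : IsCurveFamily F) (hα : DiminishingReturns F α)
    (k : Fin K) : ContinuousOn (rightLimAtZero F k) (Icc 0 1) := by
  intro x hx
  rcases hx.1.eq_or_lt with rfl | h0
  · rw [Metric.continuousWithinAt_iff]
    intro η hη
    have hz : rightLimAtZero F k 0 = sInf (F k '' Ioc 0 1) := if_pos rfl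
    obtain ⟨_, ⟨w, hw, rfl⟩, hlt⟩ := exists_lt_of_csInf_lt
      ((nonempty_Ioc.2 (one_pos (α := ℝ))).image (F k)) (lt_add_of_pos_right
        (sInf (F k '' Ioc 0 1)) hη)
    refine ⟨w, hw.1, fun {y} hy hd => ?_⟩
    rw [Real.dist_eq, sub_zero, abs_of_nonneg hy.1] at hd
    have h1 := hF.rightLimAtZero.monotoneOn k hx hy hy.1
    have h2 := hF.rightLimAtZero.monotoneOn k hy (Ioc_subset_Icc_self hw) hd.le
    rw [rightLimAtZero_eqOn k hw] at h2
    rw [hz] at h1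
    rw [hz, Real.dist_eq, abs_lt]
    constructor <;> linarith
  · have hc := hα.rightLimAtZero.contDiffOn k |>.continuousOn x ⟨h0, hx.2⟩
    refine hc.mono_of_mem_nhdsWithin ?_
    filter_upwards [self_mem_nhdsWithin, mem_nhdsWithin_of_mem_nhds (Ioi_mem_nhds h0)] with y hy h
    exact ⟨h, hy.2⟩

/-- The reward need not be upper semicontinuous, as curves may jump up just after `0`. Replacing
values at `0` by right limits gives a continuous majorant on the simplex. By the budget floor its
maximizer has positive coordinates, where the curves are unchanged, so it also maximizes the
original reward. -/
theorem exists_isOptimal (hF : IsCurveFamily F) (hα : DiminishingReturns F α)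
    (hK : 1 ≤ K) (hμ : ∀ k, μ k ∈ Ioc (0 : ℝ) 1) : ∃ x, IsOptimal F μ x := by
  have hne : (stdSimplex ℝ (Fin K)).Nonempty := ⟨_, single_mem_stdSimplex ℝ ⟨0, hK⟩⟩
  have hcont : ContinuousOn (reward (rightLimAtZero F) μ) (stdSimplex ℝ (Fin K)) := by
    refine continuousOn_finsetSum _ fun k _ => continuousOn_const.mul ?_
    exact (continuousOn_rightLimAtZero hF hα k).comp (continuous_apply k).continuousOn
      fun x hx => stdSimplex_mem_Icc hx k
  obtain ⟨x, hx, hmax⟩ := (isCompact_stdSimplex ℝ (Fin K)).exists_isMaxOn hne hcont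
  obtain ⟨j, hj⟩ := exists_one_div_le hK hx
  have hK0 : (0 : ℝ) < 1 / K := by positivity
  have hfl := IsOptimal.budgetFloor_le hF.rightLimAtZero hα.rightLimAtZero hK hμ ⟨hx, hmax⟩
    muInf_le hK0 hj ((hμ j).2.trans one_le_two)
  have hpos : ∀ k, x k ∈ Ioc (0 : ℝ) 1 := fun k =>
    ⟨(budgetFloor_mem hF.rightLimAtZero hα.rightLimAtZero hK hμ
      ⟨hK0, hj.trans (stdSimplex_mem_Icc hx j).2⟩).1.trans_le (hfl k), (stdSimplex_mem_Icc hx k).2⟩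
  refine ⟨x, hx, fun y hy => ?_⟩
  have h1 : reward F μ y ≤ reward (rightLimAtZero F) μ y :=
    Finset.sum_le_sum fun k _ => mul_le_mul_of_nonneg_left
      (le_rightLimAtZero hF k (stdSimplex_mem_Icc hy k)) (hμ k).1.le
  have h2 : reward (rightLimAtZero F) μ x = reward F μ x :=
    Finset.sum_congr rfl fun k _ => by rw [rightLimAtZero_eqOn k (hpos k)]
  exact (h1.trans (hmax hy)).trans h2.le

end Curves

/-! ### Two deterministic summation bounds -/

section Sums

theorem sum_Icc_one_eq_sum_range {M : Type*} [AddCommMonoid M] (f : ℕ → M) (n : ℕ) :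
    ∑ t ∈ Finset.Icc 1 n, f t = ∑ t ∈ Finset.range n, f (t + 1) := by
  induction n with
  | zero => simp
  | succ n ih => rw [Finset.sum_Icc_succ_top (by omega), ih, Finset.sum_range_succ]

/-- The terms added while the running sum is below `a` add up to at most `a + 1`. -/
theorem sum_ite_sum_lt_le {f : ℕ → ℝ} {a : ℝ} (ha : 0 ≤ a) {n : ℕ}
    (hf : ∀ t < n, f t ∈ Icc (0 : ℝ) 1) :
    ∑ t ∈ Finset.range n, (if ∑ s ∈ Finset.range t, f s < a then f t else 0) ≤ a + 1 := by
  -- The induction needs the full running sum as a second bound: while it is below `a`, one more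
  -- term keeps the total below `a + 1`.
  suffices h : ∑ t ∈ Finset.range n, (if ∑ s ∈ Finset.range t, f s < a then f t else 0)
      ≤ min (∑ s ∈ Finset.range n, f s) (a + 1) from h.trans (min_le_right _ _)
  induction n with
  | zero => simp; linarith
  | succ n ih =>
    have ih := ih fun t ht => hf t (ht.trans n.lt_succ_self)
    rw [Finset.sum_range_succ, Finset.sum_range_succ]
    have hn := hf n n.lt_succ_self
    have h1 := ih.trans (min_le_left _ _)
    have h2 := ih.trans (min_le_right _ _)
    refine le_min ?_ ?_ <;> split_ifs with h <;> linarith [hn.1, hn.2]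

/-- Along the indices with property `p`, inverse linear terms have a logarithmic sum. -/
theorem sum_one_div_card_le (p : ℕ → Prop) [DecidablePred p] {c : ℝ} (hc : 0 < c) (hc1 : c ≤ 1)
    (n : ℕ) :
    ∑ t ∈ Finset.range n,
      (if p t then 1 / (1 + c * ((Finset.range t).filter p).card) else 0)
      ≤ 1 / c * (1 + Real.log n) := by
  -- Reindexing by rank: at the successive indices with `p`, the cardinality runs through `0, 1, 2,
  -- …`.
  have h1 : ∑ t ∈ Finset.range n,
      (if p t then 1 / (1 + c * ((Finset.range t).filter p).card) else 0)
      = ∑ i ∈ Finset.range ((Finset.range n).filter p).card, 1 / (1 + c * (i : ℝ)) := by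
    induction n with
    | zero => simp
    | succ n ih =>
      rw [Finset.sum_range_succ, ih, Finset.range_add_one, Finset.filter_insert]
      split_ifs with h
      · rw [Finset.card_insert_of_notMem (by simp), Finset.sum_range_succ]
      · simp
  have hcard : ((Finset.range n).filter p).card ≤ n := by
    simpa using Finset.card_filter_le (Finset.range n) p
  rw [h1]
  calc ∑ i ∈ Finset.range ((Finset.range n).filter p).card, 1 / (1 + c * (i : ℝ))
      ≤ ∑ i ∈ Finset.range n, 1 / (1 + c * (i : ℝ)) :=
        Finset.sum_le_sum_of_subset_of_nonneg (Finset.range_mono hcard)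
          fun i _ _ => by positivity
    _ ≤ ∑ i ∈ Finset.range n, 1 / c * ((i : ℝ) + 1)⁻¹ := by
        refine Finset.sum_le_sum fun i _ => ?_
        rw [← one_div, one_div_mul_one_div]
        refine one_div_le_one_div_of_le (by positivity) ?_
        nlinarith
    _ = 1 / c * (harmonic n : ℝ) := by
        rw [← Finset.mul_sum, harmonic]; push_cast; rfl
    _ ≤ 1 / c * (1 + Real.log n) :=
        mul_le_mul_of_nonneg_left (harmonic_le_one_add_log n) (by positivity)

end Sums

/-! ### Deterministic regret analysis -/

section Regret

variable {K : ℕ} {F : Fin K → ℝ → ℝ} {α : ℝ → ℝ} {M : ℝ → ℝ≥0} {μ : Fin K → ℝ}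

theorem uInf_mem (hF : IsCurveFamily F) (hα : DiminishingReturns F α)
    (hK : 1 ≤ K) (hμ : ∀ k, μ k ∈ Ioc (0 : ℝ) 1) : uInf F μ ∈ Ioc (0 : ℝ) 1 := by
  have hK1 : (1 : ℝ) ≤ K := by exact_mod_cast hK
  exact budgetFloor_mem hF hα hK hμ ⟨by positivity, by rw [div_le_one (by positivity)]; exact hK1⟩

theorem uInf_le (hF : IsCurveFamily F) (hα : DiminishingReturns F α)
    (hK : 1 ≤ K) (hμ : ∀ k, μ k ∈ Ioc (0 : ℝ) 1) : uInf F μ ≤ 1 / K := by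
  have hK1 : (1 : ℝ) ≤ K := by exact_mod_cast hK
  exact BudgetBandit.budgetFloor_le hF hα hK hμ
    ⟨by positivity, by rw [div_le_one (by positivity)]; exact hK1⟩

theorem IsOptimal.uInf_le (hF : IsCurveFamily F) (hα : DiminishingReturns F α)
    (hK : 1 ≤ K) (hμ : ∀ k, μ k ∈ Ioc (0 : ℝ) 1) {m x : Fin K → ℝ} (hx : IsOptimal F m x)
    (hm : ∀ k, muInf μ ≤ m k) {j : Fin K} (hj : 1 / (K : ℝ) ≤ x j) (hmj : m j ≤ 2)
    (k : Fin K) : uInf F μ ≤ x k := by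
  have hK1 : (1 : ℝ) ≤ K := by exact_mod_cast hK
  exact hx.budgetFloor_le hF hα hK hμ hm (by positivity) hj hmj k

/-- The loss of optimizing for the weights `m` instead of `μ`. -/
theorem IsOptimal.sum_sub_le (hα : DiminishingReturns F α)
    (hM : IsLipschitzModulus F M) (hK : 1 ≤ K) (hμ : ∀ k, μ k ∈ Ioc (0 : ℝ) 1)
    {m x xs b : Fin K → ℝ} (hx : IsOptimal F m x) (hxs : xs ∈ stdSimplex ℝ (Fin K))
    {u : ℝ} (hu : u ∈ Ioc (0 : ℝ) 1) (hxu : ∀ k, u ≤ x k) (hxsu : ∀ k, u ≤ xs k)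
    (hm : ∀ k, muInf μ ≤ m k) (hb : ∀ k, |m k - μ k| ≤ 2 * b k) :
    ∑ k, (μ k * F k (xs k) - μ k * F k (x k))
      ≤ ∑ k, 4 * (M u : ℝ) ^ 2 / (muInf μ * α u) * b k ^ 2 := by
  have hmi := muInf_mem hK hμ
  have hαu := hα.alpha_pos u hu
  have hA : 0 < muInf μ * α u := mul_pos hmi.1 hαu
  have hxI : ∀ k, x k ∈ Icc u 1 := fun k => ⟨hxu k, (stdSimplex_mem_Icc hx.1 k).2⟩
  have hxsI : ∀ k, xs k ∈ Icc u 1 := fun k => ⟨hxsu k, (stdSimplex_mem_Icc hxs k).2⟩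
  set z : Fin K → ℝ := (1 / 2 : ℝ) • x + (1 / 2 : ℝ) • xs with hz
  have hzs : z ∈ stdSimplex ℝ (Fin K) :=
    convex_stdSimplex ℝ (Fin K) hx.1 hxs (by norm_num) (by norm_num) (by norm_num)
  have hopt : reward F m z ≤ reward F m x := hx.2 hzs
  have hmid : ∀ k, m k * (1 / 2 * F k (x k) + 1 / 2 * F k (xs k)
      + α u / 8 * (xs k - x k) ^ 2) ≤ m k * F k (z k) := by
    intro k
    refine mul_le_mul_of_nonneg_left ?_ (hmi.1.le.trans (hm k))
    obtain ⟨-, hsc⟩ := hα.strongConcaveOn k u hu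
    have := @hsc (x k) (hxI k) (xs k) (hxsI k) (1 / 2) (1 / 2) (by norm_num) (by norm_num)
      (by norm_num)
    simp only [smul_eq_mul, Real.norm_eq_abs, sq_abs] at this
    have hzk : z k = 1 / 2 * x k + 1 / 2 * xs k := by simp [hz]
    rw [hzk]
    linarith
  have hsum : ∑ k, m k * (1 / 2 * F k (x k) + 1 / 2 * F k (xs k)
      + α u / 8 * (xs k - x k) ^ 2) ≤ ∑ k, m k * F k (x k) :=
    (Finset.sum_le_sum fun k _ => hmid k).trans hopt
  -- The right side sums to at most zero by `hsum`. The error of `m` is split off with the Lipschitz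
  -- bound and then with `2bMd ≤ 4M²b²/(μα) + μαd²/4`, whose last term is the strong concavity gain.
  have hterm : ∀ k, (μ k * F k (xs k) - μ k * F k (x k))
      - 4 * (M u : ℝ) ^ 2 / (muInf μ * α u) * b k ^ 2
      ≤ 2 * (m k * (1 / 2 * F k (x k) + 1 / 2 * F k (xs k) + α u / 8 * (xs k - x k) ^ 2)
        - m k * F k (x k)) := by
    intro k
    set d := |xs k - x k| with hd
    have hd2 : (xs k - x k) ^ 2 = d ^ 2 := (sq_abs _).symm
    have hlip : |F k (xs k) - F k (x k)| ≤ M u * d := by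
      have := (hM.lipschitzOnWith k u hu).dist_le_mul _ (hxsI k) _ (hxI k)
      simpa [Real.dist_eq] using this
    have hprod : -((m k - μ k) * (F k (xs k) - F k (x k))) ≤ 2 * b k * (M u * d) := by
      refine (neg_le_abs _).trans ?_
      rw [abs_mul]
      exact mul_le_mul (hb k) hlip (abs_nonneg _) ((abs_nonneg _).trans (hb k))
    have hlow : muInf μ * α u * d ^ 2 ≤ m k * α u * d ^ 2 := by
      have := hm k
      gcongr
    have hamgm : 2 * b k * (M u * d) ≤ 4 * (M u : ℝ) ^ 2 / (muInf μ * α u) * b k ^ 2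
        + muInf μ * α u / 4 * d ^ 2 := by
      rw [div_mul_eq_mul_div, ← sub_nonneg]
      have hmi0 := hmi.1.ne'
      have : 4 * (M u : ℝ) ^ 2 * b k ^ 2 / (muInf μ * α u) + muInf μ * α u / 4 * d ^ 2
          - 2 * b k * (M u * d)
          = (muInf μ * α u * d / 2 - 2 * M u * b k) ^ 2 / (muInf μ * α u) := by
        field_simp
        ring
      rw [this]
      positivity
    rw [hd2]
    linarith
  have := Finset.sum_le_sum fun k (_ : k ∈ Finset.univ) => hterm k
  rw [Finset.sum_sub_distrib (f := fun k => μ k * F k (xs k) - μ k * F k (x k)),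
    ← Finset.mul_sum Finset.univ (fun k => _ - m k * F k (x k)), Finset.sum_sub_distrib
      (g := fun k => m k * F k (x k))] at this
  linarith

theorem sum_sub_le_card (hF : IsCurveFamily F) (hμ : ∀ k, μ k ∈ Ioc (0 : ℝ) 1)
    {x xs : Fin K → ℝ} (hx : x ∈ stdSimplex ℝ (Fin K)) (hxs : xs ∈ stdSimplex ℝ (Fin K)) :
    ∑ k, (μ k * F k (xs k) - μ k * F k (x k)) ≤ K := by
  have : ∀ k ∈ Finset.univ, μ k * F k (xs k) - μ k * F k (x k) ≤ 1 := by
    intro k _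
    have h1 := hF.mapsTo k (stdSimplex_mem_Icc hxs k)
    have h2 := hF.mapsTo k (stdSimplex_mem_Icc hx k)
    nlinarith [(hμ k).1, (hμ k).2, h1.1, h1.2, h2.1, h2.2, mul_nonneg (hμ k).1.le h2.1]
  simpa using Finset.sum_le_card_nsmul _ _ _ this

theorem iInf_curve_pos (hF : IsCurveFamily F) (hα : DiminishingReturns F α) (hK : 1 ≤ K) {u : ℝ}
    (hu : u ∈ Ioc (0 : ℝ) 1) : 0 < ⨅ k, F k u := by
  have : Nonempty (Fin K) := ⟨⟨0, hK⟩⟩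
  obtain ⟨k, hk⟩ := exists_eq_ciInf_of_finite (f := fun k => F k u)
  rw [← hk]
  exact curve_pos hF hα k hu

theorem iInf_curve_le (hF : IsCurveFamily F) (k : Fin K) {u x : ℝ} (hu : u ∈ Ioc (0 : ℝ) 1)
    (hx : x ∈ Icc u 1) : ⨅ k, F k u ≤ F k x :=
  (ciInf_le (Finite.bddBelow_range _) k).trans (hF.monotoneOn k (Ioc_subset_Icc_self hu)
    ⟨hu.1.le.trans hx.1, hx.2⟩ hx.1)

/-- The regret of optimistic play, for confidence bounds `U` that are valid, with completion
counts `N` that are at least half the expected ones from the level `a` on. -/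
theorem sum_regret_le (hF : IsCurveFamily F) (hα : DiminishingReturns F α)
    (hM : IsLipschitzModulus F M) (hK : 1 ≤ K) (hμ : ∀ k, μ k ∈ Ioc (0 : ℝ) 1)
    {x U N : ℕ → Fin K → ℝ} {xs : Fin K → ℝ} {T : ℕ} {l a : ℝ} (hl : 0 ≤ l) (ha : 0 ≤ a)
    (hal : 4 * l ≤ 1 + a / 2) (hopt : ∀ t < T, IsOptimal F (U t) (x (t + 1)))
    (hxs : IsOptimal F μ xs)
    (hU : ∀ t < T, ∀ k, μ k ≤ U t k ∧ U t k ≤ μ k + 2 * √(l / (1 + N t k)))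
    (hN0 : ∀ t k, 0 ≤ N t k)
    (hN : ∀ t < T, ∀ k, a ≤ ∑ s ∈ Finset.range t, F k (x (s + 1) k) →
      (∑ s ∈ Finset.range t, F k (x (s + 1) k)) / 2 ≤ N t k) :
    ∑ t ∈ Finset.Icc 1 T, ∑ k, (μ k * F k (xs k) - μ k * F k (x t k))
      ≤ (K : ℝ) ^ 2 * (a + 1) / (⨅ k, F k (uInf F μ))
        + 8 * (M (uInf F μ) : ℝ) ^ 2 * l * K /
          (muInf μ * α (uInf F μ) * ⨅ k, F k (uInf F μ)) * (1 + Real.log T) := by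
  classical
  have hK0 : (0 : ℝ) < 1 / K := by positivity
  set u := uInf F μ with hu_def
  have hu : u ∈ Ioc (0 : ℝ) 1 := uInf_mem hF hα hK hμ
  have huK : u ≤ 1 / K := uInf_le hF hα hK hμ
  have hmi := muInf_mem hK hμ
  have hαu := hα.alpha_pos u hu
  set φ := ⨅ k, F k u with hφ_def
  have hφ : 0 < φ := iInf_curve_pos hF hα hK hu
  have hφ1 : φ ≤ 1 := (iInf_curve_le hF ⟨0, hK⟩ hu ⟨hu.2, le_rfl⟩).trans
    (hF.mapsTo _ (right_mem_Icc.2 zero_le_one)).2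
  set S : ℕ → Fin K → ℝ := fun t k => ∑ s ∈ Finset.range t, F k (x (s + 1) k) with hS
  -- Good rounds: every task has reached level `a`, so all widths are at most `1 / 2` and all
  -- weights at most `2`.
  set p : ℕ → Prop := fun t => ∀ k, a ≤ S t k with hp
  have hxm : ∀ t < T, ∀ k, x (t + 1) k ∈ Icc (0 : ℝ) 1 := fun t ht =>
    stdSimplex_mem_Icc (hopt t ht).1
  have hFx : ∀ t < T, ∀ k, F k (x (t + 1) k) ∈ Icc (0 : ℝ) 1 := fun t ht k =>
    hF.mapsTo k (hxm t ht k)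
  have hUm : ∀ t < T, ∀ k, muInf μ ≤ U t k := fun t ht k => (muInf_le k).trans (hU t ht k).1
  have hU2 : ∀ t < T, ∀ k, a ≤ S t k → U t k ≤ 2 := by
    intro t ht k hk
    have h1 := hN t ht k hk
    have h2 : √(l / (1 + N t k)) ≤ 1 / 2 := by
      rw [Real.sqrt_le_left (by norm_num), div_le_iff₀ (by linarith [hN0 t k])]
      have : a ≤ ∑ s ∈ Finset.range t, F k (x (s + 1) k) := hk
      linarith
    linarith [(hU t ht k).2, (hμ k).2]
  have hfloor : ∀ t < T, p t → ∀ k, u ≤ x (t + 1) k := by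
    intro t ht hpt k
    obtain ⟨j, hj⟩ := exists_one_div_le hK (hopt t ht).1
    exact (hopt t ht).uInf_le hF hα hK hμ (hUm t ht) hj (hU2 t ht j (hpt j)) k
  have hxsu : ∀ k, u ≤ xs k := by
    obtain ⟨j, hj⟩ := exists_one_div_le hK hxs.1
    exact hxs.uInf_le hF hα hK hμ muInf_le hj ((hμ j).2.trans one_le_two)
  -- rounds in which some task has a low expected completion count
  have hlow : ∀ t < T, ¬ p t → φ ≤ ∑ k, if S t k < a then F k (x (t + 1) k) else 0 := by
    intro t ht hpt
    -- Take `j` with budget at least `1 / K`. If `j` has reached level `a`, its weight is at most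
    -- `2` and the floor covers every low task; otherwise `j` is itself low, and `u ≤ 1 / K`.
    have hex : ∃ k, S t k < a ∧ u ≤ x (t + 1) k := by
      obtain ⟨j, hj⟩ := exists_one_div_le hK (hopt t ht).1
      by_cases hja : a ≤ S t j
      · simp only [hp, not_forall, not_le] at hpt
        obtain ⟨k, hk⟩ := hpt
        exact ⟨k, hk, (hopt t ht).uInf_le hF hα hK hμ (hUm t ht) hj (hU2 t ht j hja) k⟩
      · exact ⟨j, not_le.1 hja, huK.trans hj⟩
    obtain ⟨k, hk, hxk⟩ := hex
    refine (iInf_curve_le hF k hu ⟨hxk, (hxm t ht k).2⟩).trans ?_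
    refine le_trans ?_ (Finset.single_le_sum (f := fun k => if S t k < a then F k (x (t + 1) k)
      else 0) (fun i _ => ?_) (Finset.mem_univ k))
    · simp [hk]
    · split_ifs
      exacts [(hFx t ht i).1, le_rfl]
  have hcount : ∑ t ∈ Finset.range T, (if p t then 0 else φ) ≤ K * (a + 1) := by
    calc ∑ t ∈ Finset.range T, (if p t then 0 else φ)
        ≤ ∑ t ∈ Finset.range T, ∑ k, (if S t k < a then F k (x (t + 1) k) else 0) := by
          refine Finset.sum_le_sum fun t ht => ?_
          have ht := Finset.mem_range.1 ht
          split_ifs with h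
          · refine Finset.sum_nonneg fun i _ => ?_
            split_ifs
            exacts [(hFx t ht i).1, le_rfl]
          · exact hlow t ht h
      _ = ∑ k, ∑ t ∈ Finset.range T, (if S t k < a then F k (x (t + 1) k) else 0) :=
          Finset.sum_comm
      _ ≤ ∑ _k : Fin K, (a + 1) := Finset.sum_le_sum fun k _ =>
          sum_ite_sum_lt_le (f := fun t => F k (x (t + 1) k)) ha fun t ht => hFx t ht k
      _ = K * (a + 1) := by simp [mul_add]
  -- Only earlier good rounds are counted, each adding at least `φ` to the expected count; the
  -- factor `1 / 2` is the loss in `hN`.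
  have hNlow : ∀ t < T, p t → ∀ k,
      φ / 2 * ((Finset.range t).filter p).card ≤ N t k := by
    intro t ht hpt k
    refine le_trans ?_ (hN t ht k (hpt k))
    have : ((Finset.range t).filter p).card • φ ≤ S t k :=
      calc ((Finset.range t).filter p).card • φ
          ≤ ∑ s ∈ (Finset.range t).filter p, F k (x (s + 1) k) := by
            refine Finset.card_nsmul_le_sum _ _ _ fun s hs => ?_
            rw [Finset.mem_filter, Finset.mem_range] at hs
            exact iInf_curve_le hF k hu
              ⟨hfloor s (hs.1.trans ht) hs.2 k, (hxm s (hs.1.trans ht) k).2⟩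
        _ ≤ S t k := Finset.sum_le_sum_of_subset_of_nonneg (Finset.filter_subset _ _)
            fun s hs _ => (hFx s ((Finset.mem_range.1 hs).trans ht) k).1
    rw [nsmul_eq_mul] at this
    have h3 : S t k = ∑ s ∈ Finset.range t, F k (x (s + 1) k) := rfl
    rw [← h3]
    linarith
  set A := 4 * (M u : ℝ) ^ 2 / (muInf μ * α u) with hA
  have hA0 : 0 ≤ A := by have := hmi.1; positivity
  have hround : ∀ t < T, ∑ k, (μ k * F k (xs k) - μ k * F k (x (t + 1) k))
      ≤ K / φ * (if p t then 0 else φ)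
        + A * l * K * (if p t then 1 / (1 + φ / 2 * ((Finset.range t).filter p).card) else 0) := by
    intro t ht
    split_ifs with h
    · have h1 := (hopt t ht).sum_sub_le hα hM hK hμ (b := fun k => √(l / (1 + N t k)))
        hxs.1 hu (hfloor t ht h) hxsu (hUm t ht) (fun k => by
          rw [abs_of_nonneg (by linarith [(hU t ht k).1])]
          linarith [(hU t ht k).2])
      refine h1.trans ?_
      rw [mul_zero, zero_add]
      have h2 : ∀ k ∈ (Finset.univ : Finset (Fin K)), A * √(l / (1 + N t k)) ^ 2
          ≤ A * l * (1 / (1 + φ / 2 * ((Finset.range t).filter p).card)) := by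
        intro k _
        have hNk := hN0 t k
        rw [Real.sq_sqrt (by positivity), mul_assoc, mul_one_div]
        have := hNlow t ht h k
        gcongr
      refine (Finset.sum_le_card_nsmul _ _ _ h2).trans_eq ?_
      rw [Finset.card_univ, Fintype.card_fin, nsmul_eq_mul]
      ring
    · rw [mul_zero, add_zero, div_mul_cancel₀ _ hφ.ne']
      exact sum_sub_le_card hF hμ (hopt t ht).1 hxs.1
  rw [sum_Icc_one_eq_sum_range]
  refine (Finset.sum_le_sum fun t ht => hround t (Finset.mem_range.1 ht)).trans ?_
  rw [Finset.sum_add_distrib, ← Finset.mul_sum, ← Finset.mul_sum]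
  refine add_le_add ?_ ?_
  · calc _ ≤ K / φ * (K * (a + 1)) := mul_le_mul_of_nonneg_left hcount (by positivity)
      _ = _ := by ring
  · calc _ ≤ A * l * K * (1 / (φ / 2) * (1 + Real.log T)) :=
          mul_le_mul_of_nonneg_left (sum_one_div_card_le p (by positivity) (by linarith) T)
            (by positivity)
      _ = _ := by
          have := hmi.1.ne'
          rw [hA]; field_simp; ring

/-- The argument needs only the floor at `1 / K`. The floor at `1 / K ^ 2` is lower, so putting it
into the denominator of the final bound merely weakens it. -/
theorem iInf_curve_budgetFloor_le (hF : IsCurveFamily F) (hα : DiminishingReturns F α)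
    (hK : 1 ≤ K) (hμ : ∀ k, μ k ∈ Ioc (0 : ℝ) 1) :
    0 < ⨅ k, F k (budgetFloor F μ (1 / (K : ℝ) ^ 2)) ∧
      ⨅ k, F k (budgetFloor F μ (1 / (K : ℝ) ^ 2)) ≤ ⨅ k, F k (uInf F μ) := by
  have : Nonempty (Fin K) := ⟨⟨0, hK⟩⟩
  have hK1 : (1 : ℝ) ≤ K := by exact_mod_cast hK
  have hle : 1 / (K : ℝ) ^ 2 ≤ 1 / K := by
    apply one_div_le_one_div_of_le <;> nlinarith
  have hK2 : 1 / (K : ℝ) ≤ 1 := by rw [div_le_one (by positivity)]; exact hK1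
  have hv := budgetFloor_mem hF hα hK hμ (v := 1 / (K : ℝ) ^ 2)
    ⟨by positivity, hle.trans hK2⟩
  exact ⟨iInf_curve_pos hF hα hK hv, le_ciInf fun k => iInf_curve_le hF k hv
    ⟨budgetFloor_mono hF hα hK hμ (by positivity) hle hK2, (uInf_mem hF hα hK hμ).2⟩⟩

/-- The bound of `sum_regret_le` in the shape of `regretBound`. -/
theorem sum_regret_bound_le_regretBound (hF : IsCurveFamily F) (hα : DiminishingReturns F α)
    (hK : 1 ≤ K) (hμ : ∀ k, μ k ∈ Ioc (0 : ℝ) 1) {T : ℕ} (hT : 1 ≤ Real.log T) {δ c : ℝ}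
    (hδ : 0 ≤ Real.log (2 / δ)) (hc : 0 ≤ c) :
    (K : ℝ) ^ 2 * (400 * Real.log T ^ 2 + 1) / (⨅ k, F k (uInf F μ))
        + 8 * (M (uInf F μ) : ℝ) ^ 2 * Real.log (2 / δ) * K /
          (muInf μ * α (uInf F μ) * ⨅ k, F k (uInf F μ)) * (1 + Real.log T)
      ≤ regretBound F α M μ T δ c := by
  obtain ⟨hv, hvu⟩ := iInf_curve_budgetFloor_le hF hα hK hμ
  have hu := hv.trans_le hvu
  have hmi := (muInf_mem hK hμ).1
  have hαu := hα.alpha_pos _ (uInf_mem hF hα hK hμ)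
  have h1 : (K : ℝ) ^ 2 * (400 * Real.log T ^ 2 + 1) / (⨅ k, F k (uInf F μ))
      ≤ 4 * (K : ℝ) ^ 2 * (100 * Real.log T ^ 2 + 1) /
        ⨅ k, F k (budgetFloor F μ (1 / (K : ℝ) ^ 2)) := by
    refine div_le_div₀ (by positivity) ?_ hv hvu
    nlinarith [sq_nonneg (K : ℝ)]
  set D := muInf μ * α (uInf F μ) * ⨅ k, F k (uInf F μ) with hD
  have hD0 : 0 < D := by positivity
  have h2 : 8 * (M (uInf F μ) : ℝ) ^ 2 * Real.log (2 / δ) * K / D * (1 + Real.log T)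
      ≤ 32 * (M (uInf F μ) : ℝ) ^ 2 * Real.log (2 / δ) * K / D * Real.log T := by
    have hq : 0 ≤ 8 * (M (uInf F μ) : ℝ) ^ 2 * Real.log (2 / δ) * K / D := by positivity
    have : 32 * (M (uInf F μ) : ℝ) ^ 2 * Real.log (2 / δ) * K / D
        = 4 * (8 * (M (uInf F μ) : ℝ) ^ 2 * Real.log (2 / δ) * K / D) := by ring
    rw [this]
    nlinarith
  have h3 : 0 ≤ c * (K : ℝ) ^ 2 := by positivity
  unfold regretBound
  linarith

end Regret

/-! ### Independence and supermartingale tails -/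

section General

theorem measurable_apply_of_le {Ω : Type*} {m m' : MeasurableSpace Ω} {B : ℝ → Ω → ℝ}
    (hB : Measurable[MeasurableSpace.prod inferInstance m'] fun p : ℝ × Ω => B p.1 p.2)
    (hm : m' ≤ m) {Y : Ω → ℝ} (hY : Measurable[m] Y) : Measurable[m] fun ω => B (Y ω) ω := by
  have h : @Measurable _ _ m (@Prod.instMeasurableSpace _ _ _ m') fun ω => (Y ω, ω) :=
    @Measurable.prodMk _ _ _ _ _ _ _ _ hY (measurable_id'' hm)
  exact hB.comp h

variable {Ω : Type*} [mΩ : MeasurableSpace Ω] {P : Measure Ω} [IsProbabilityMeasure P]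

/-- The expectation of a function of two independent variables is an iterated expectation. -/
theorem integral_eq_integral_integral_of_indepFun {A C : Type*} [MeasurableSpace A]
    [MeasurableSpace C] {f : Ω → A} {g : Ω → C} (hfg : IndepFun f g P) (hf : Measurable f)
    (hg : Measurable g) {h : A × C → ℝ} (hh : Measurable h)
    (hi : Integrable (fun ω => h (f ω, g ω)) P) :
    ∫ ω, h (f ω, g ω) ∂P = ∫ ω, ∫ ω', h (f ω, g ω') ∂P ∂P := by
  have : IsProbabilityMeasure (P.map f) := Measure.isProbabilityMeasure_map hf.aemeasurable
  have : IsProbabilityMeasure (P.map g) := Measure.isProbabilityMeasure_map hg.aemeasurable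
  have hmap := (indepFun_iff_map_prod_eq_prod_map_map hf.aemeasurable hg.aemeasurable).1 hfg
  have hint : Integrable h ((P.map f).prod (P.map g)) := by
    rw [← hmap]
    exact (integrable_map_measure hh.aestronglyMeasurable (hf.prodMk hg).aemeasurable).2 hi
  calc ∫ ω, h (f ω, g ω) ∂P = ∫ p, h p ∂(P.map fun ω => (f ω, g ω)) :=
        (integral_map (hf.prodMk hg).aemeasurable hh.aestronglyMeasurable).symm
    _ = ∫ a, ∫ c, h (a, c) ∂(P.map g) ∂(P.map f) := by rw [hmap, integral_prod _ hint]
    _ = ∫ ω, ∫ c, h (f ω, c) ∂(P.map g) ∂P :=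
        integral_map hf.aemeasurable
          (StronglyMeasurable.integral_prod_right (f := fun a c => h (a, c))
            hh.stronglyMeasurable).aestronglyMeasurable
    _ = ∫ ω, ∫ ω', h (f ω, g ω') ∂P ∂P := by
        refine integral_congr_ae (ae_of_all _ fun ω => ?_)
        exact integral_map hg.aemeasurable
          (hh.comp measurable_prodMk_left).aestronglyMeasurable

theorem measurable_snd_mul_apply {C : Type*} [MeasurableSpace C] {B : ℝ → C → ℝ}
    (hB : Measurable fun p : ℝ × C => B p.1 p.2) :
    Measurable fun p : (ℝ × ℝ) × C => p.1.2 * B p.1.1 p.2 :=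
  (measurable_snd.comp measurable_fst).mul
    (hB.comp ((measurable_fst.comp measurable_fst).prodMk measurable_snd))

theorem integrable_of_forall_abs_le {f : Ω → ℝ} (hf : Measurable f) {c : ℝ}
    (hc : ∀ ω, |f ω| ≤ c) : Integrable f P :=
  Integrable.of_bound hf.aestronglyMeasurable c (ae_of_all _ hc)

/-- Tail bound for a sum whose exponential is a supermartingale. -/
theorem measureReal_le_sum_le {m : ℕ → MeasurableSpace Ω} (hm : ∀ t, m t ≤ mΩ) (hmono : Monotone m)
    {D : ℕ → Ω → ℝ} {n : ℕ} {c : ℝ} (hD : ∀ s < n, Measurable[m (s + 1)] (D s))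
    (hc : ∀ s < n, ∀ ω, |D s ω| ≤ c)
    (hstep : ∀ s < n, ∀ Z : Ω → ℝ, Measurable[m s] Z → (∀ ω, 0 ≤ Z ω) → (∃ C, ∀ ω, Z ω ≤ C) →
      ∫ ω, Z ω * Real.exp (D s ω) ∂P ≤ ∫ ω, Z ω ∂P) (b : ℝ) :
    P.real {ω | b ≤ ∑ s ∈ Finset.range n, D s ω} ≤ Real.exp (-b) := by
  have hmeas : ∀ t ≤ n, Measurable[m t] fun ω => Real.exp (∑ s ∈ Finset.range t, D s ω) := by
    intro t ht
    refine Real.measurable_exp.comp (Finset.measurable_fun_sum _ fun s hs => ?_)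
    have hs := Finset.mem_range.1 hs
    exact (hD s (hs.trans_le ht)).mono (hmono hs) le_rfl
  have hbd : ∀ t ≤ n, ∀ ω, Real.exp (∑ s ∈ Finset.range t, D s ω) ≤ Real.exp (t * c) := by
    intro t ht ω
    refine Real.exp_le_exp.2 ?_
    simpa using Finset.sum_le_card_nsmul (Finset.range t) (fun s => D s ω) c fun s hs =>
      (le_abs_self _).trans (hc s ((Finset.mem_range.1 hs).trans_le ht) ω)
  -- `hstep`, tested against bounded nonnegative `Z`, stands in for a conditional expectation; here
  -- `Z` is the exponential of the preceding partial sum. Markov's inequality then gives the tail.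
  have hle : ∀ t ≤ n, ∫ ω, Real.exp (∑ s ∈ Finset.range t, D s ω) ∂P ≤ 1 := by
    intro t
    induction t with
    | zero => intro _; simp
    | succ t ih =>
      intro ht
      refine le_trans ?_ (ih (by omega))
      simp_rw [Finset.sum_range_succ, Real.exp_add]
      exact hstep t ht _ (hmeas t (by omega)) (fun ω => (Real.exp_pos _).le)
        ⟨_, hbd t (by omega)⟩
  have hint : Integrable (fun ω => Real.exp (∑ s ∈ Finset.range n, D s ω)) P :=
    integrable_of_forall_abs_le ((hmeas n le_rfl).mono (hm n) le_rfl) fun ω => by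
      rw [abs_of_pos (Real.exp_pos _)]; exact hbd n le_rfl ω
  have hmk := mul_meas_ge_le_integral_of_nonneg (ae_of_all _ fun ω => (Real.exp_pos _).le) hint
    (Real.exp b)
  simp only [Real.exp_le_exp] at hmk
  rw [Real.exp_neg, ← one_div, le_div_iff₀ (Real.exp_pos b), mul_comm]
  exact hmk.trans (hle n le_rfl)

end General

/-! ### Filtration of the environment and one-step estimates -/

namespace Environment

variable {Ω : Type*} [mΩ : MeasurableSpace Ω] {P : Measure Ω} {K : ℕ}
  {F : Fin K → ℝ → ℝ} {μ : Fin K → ℝ}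

/-- The sources of randomness of the rounds, the noise of the tasks and the rewards. -/
@[reducible]
def source (E : Environment P F μ) : ℕ ⊕ ℕ → MeasurableSpace Ω :=
  Sum.elim E.noise (fun t => MeasurableSpace.comap (E.G t) inferInstance)

theorem source_le (E : Environment P F μ) (i : ℕ ⊕ ℕ) : E.source i ≤ mΩ := by
  rcases i with t | t
  · exact E.noise_le t
  · exact (E.measurable_G t).comap_le

/-- The uncensored `σ`-algebra of the rounds up to `t`. -/
@[reducible]
def past (E : Environment P F μ) (t : ℕ) : MeasurableSpace Ω :=
  ⨆ i ∈ {i : ℕ ⊕ ℕ | Sum.elim id id i ≤ t}, E.source i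

theorem past_le (E : Environment P F μ) (t : ℕ) : E.past t ≤ mΩ :=
  iSup₂_le fun i _ => E.source_le i

theorem past_mono (E : Environment P F μ) : Monotone E.past := fun _ _ h =>
  biSup_mono fun _ hi => le_trans hi h

theorem noise_le_past (E : Environment P F μ) (t : ℕ) : E.noise t ≤ E.past t :=
  le_biSup E.source (i := Sum.inl t) (show Sum.elim id id (Sum.inl t : ℕ ⊕ ℕ) ≤ t from le_rfl)

theorem measurable_G_past (E : Environment P F μ) (t : ℕ) : Measurable[E.past t] (E.G t) :=
  Measurable.of_comap_le
    (le_biSup E.source (i := Sum.inr t) (show Sum.elim id id (Sum.inr t : ℕ ⊕ ℕ) ≤ t from le_rfl))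

theorem indep_past_noise (E : Environment P F μ) (t : ℕ) :
    Indep (E.past t) (E.noise (t + 1)) P := by
  have h := indep_iSup_of_disjoint E.source_le E.indep
    (S := {i : ℕ ⊕ ℕ | Sum.elim id id i ≤ t}) (T := {Sum.inl (t + 1)}) (by simp)
  rw [iSup_singleton] at h
  exact h

/-- The noise of the current round is included, so whether a reward is observed does not bias it. -/
theorem indep_past_sup_noise_G (E : Environment P F μ) (t : ℕ) :
    Indep (E.past t ⊔ E.noise (t + 1)) (MeasurableSpace.comap (E.G (t + 1)) inferInstance) P := by
  have h := indep_iSup_of_disjoint E.source_le E.indep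
    (S := insert (Sum.inl (t + 1)) {i : ℕ ⊕ ℕ | Sum.elim id id i ≤ t})
    (T := {Sum.inr (t + 1)}) (by simp)
  rw [iSup_singleton, iSup_insert, sup_comm] at h
  exact h

theorem measurable_done (E : Environment P F μ) {X : ℕ → Ω → Fin K → ℝ} {s t : ℕ} (k : Fin K)
    (hst : s ≤ t) (hX : Measurable[E.past t] (X s)) : Measurable[E.past t] (E.done X s k) :=
  measurable_apply_of_le (E.measurable_B s k) ((E.noise_le_past s).trans (E.past_mono hst))
    ((measurable_pi_apply k).comp hX)

variable {X : ℕ → Ω → Fin K → ℝ} {T : ℕ}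

/-- Strong induction, since feedback and allocations determine each other: allocations up to round
`t` depend only on earlier feedback, hence are measurable for the past. -/
theorem history_le_past (E : Environment P F μ)
    (hX : ∀ t < T, Measurable[E.history X t] (X (t + 1))) :
    ∀ t ≤ T, E.history X t ≤ E.past t := by
  intro t
  induction t using Nat.strong_induction_on with
  | _ t ih =>
    intro ht
    refine iSup₂_le fun s hs => iSup_le fun k => ?_
    obtain ⟨h1, h2⟩ := Finset.mem_Icc.1 hs
    obtain ⟨r, rfl⟩ : ∃ r, s = r + 1 := ⟨s - 1, by omega⟩
    have hXr : Measurable[E.past t] (X (r + 1)) :=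
      (hX r (by omega)).mono ((ih r (by omega) (by omega)).trans (E.past_mono (by omega))) le_rfl
    have hd : Measurable[E.past t] (E.done X (r + 1) k) :=
      E.measurable_done k h2 hXr
    have hG : Measurable[E.past t] (E.G (r + 1)) :=
      (E.measurable_G_past _).mono (E.past_mono h2) le_rfl
    exact sup_le hd.comap_le (hd.mul ((measurable_pi_apply k).comp hG)).comap_le

theorem measurable_allocation (E : Environment P F μ)
    (hX : ∀ t < T, Measurable[E.history X t] (X (t + 1))) {t : ℕ} (ht : t < T) :
    Measurable[E.past t] (X (t + 1)) :=
  (hX t ht).mono (E.history_le_past hX t ht.le) le_rfl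

theorem measurable_done_past (E : Environment P F μ)
    (hX : ∀ t < T, Measurable[E.history X t] (X (t + 1))) {t : ℕ} (ht : t < T) (k : Fin K) :
    Measurable[E.past (t + 1)] (E.done X (t + 1) k) :=
  E.measurable_done k le_rfl
    ((E.measurable_allocation hX ht).mono (E.past_mono t.le_succ) le_rfl)

theorem done_mem (E : Environment P F μ) (t : ℕ) (k : Fin K) (ω : Ω) :
    E.done X t k ω ∈ Icc (0 : ℝ) 1 := by
  rcases E.B_eq_zero_or_one t k (X t ω k) ω with h | h <;> simp [done, h]

variable [IsProbabilityMeasure P]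

/-- Given the past, task `k` is completed with probability `F k` of its budget. -/
theorem integral_mul_done (E : Environment P F μ) {t : ℕ} (k : Fin K)
    (hX : Measurable[E.past t] (X (t + 1))) (hX01 : ∀ ω, X (t + 1) ω k ∈ Icc (0 : ℝ) 1)
    {Z : Ω → ℝ} (hZ : Measurable[E.past t] Z) {c : ℝ} (hc : ∀ ω, |Z ω| ≤ c) :
    ∫ ω, Z ω * E.done X (t + 1) k ω ∂P = ∫ ω, Z ω * F k (X (t + 1) ω k) ∂P := by
  have hXk : Measurable[E.past t] fun ω => X (t + 1) ω k := (measurable_pi_apply k).comp hX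
  have hf : Measurable[E.past t] fun ω => (X (t + 1) ω k, Z ω) := hXk.prodMk hZ
  -- The second variable is the identity into `Ω` with the noise `σ`-algebra of the round, so the
  -- past can be frozen while the completion is averaged.
  have hind : @IndepFun Ω (ℝ × ℝ) Ω mΩ _ (E.noise (t + 1)) (fun ω => (X (t + 1) ω k, Z ω))
      (fun ω => ω) P := by
    refine (@IndepFun_iff_Indep Ω (ℝ × ℝ) Ω mΩ _ (E.noise (t + 1)) _ _ P).2 ?_
    exact indep_of_indep_of_le (E.indep_past_noise t) hf.comap_le
      (@MeasurableSpace.comap_id _ (E.noise (t + 1))).le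
  have hh : @Measurable ((ℝ × ℝ) × Ω) ℝ (@Prod.instMeasurableSpace _ _ _ (E.noise (t + 1))) _
      (fun p => p.1.2 * E.B (t + 1) k p.1.1 p.2) := by
    exact @measurable_snd_mul_apply Ω (E.noise (t + 1)) (E.B (t + 1) k) (E.measurable_B (t + 1) k)
  have hint : Integrable (fun ω => Z ω * E.B (t + 1) k (X (t + 1) ω k) ω) P := by
    refine integrable_of_forall_abs_le (c := c) ?_ fun ω => ?_
    · exact (hZ.mono (E.past_le _) le_rfl).mul
        ((E.measurable_done k le_rfl (hX.mono (E.past_mono t.le_succ) le_rfl)).mono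
          (E.past_le _) le_rfl)
    · have h0 : 0 ≤ c := (abs_nonneg _).trans (hc ω)
      rcases E.B_eq_zero_or_one (t + 1) k (X (t + 1) ω k) ω with h | h <;> simp [h, hc ω, h0]
  have := @integral_eq_integral_integral_of_indepFun Ω mΩ P _ (ℝ × ℝ) Ω _ (E.noise (t + 1)) _ _
    hind (hf.mono (E.past_le _) le_rfl) (measurable_id'' (E.noise_le (t + 1))) _ hh hint
  refine this.trans (integral_congr_ae (ae_of_all _ fun ω => ?_))
  simp only [integral_const_mul]
  rw [E.B_mean (t + 1) k _ (hX01 ω)]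

/-- The exponential supermartingale of the completions. -/
theorem integral_mul_exp_done_le (E : Environment P F μ) (hF : IsCurveFamily F) {t : ℕ} (k : Fin K)
    (hX : Measurable[E.past t] (X (t + 1))) (hX01 : ∀ ω, X (t + 1) ω k ∈ Icc (0 : ℝ) 1)
    (hFX : Measurable[E.past t] fun ω => F k (X (t + 1) ω k))
    {Z : Ω → ℝ} (hZ : Measurable[E.past t] Z) (hZ0 : ∀ ω, 0 ≤ Z ω) {c : ℝ} (hc : ∀ ω, Z ω ≤ c) :
    ∫ ω, Z ω * Real.exp (F k (X (t + 1) ω k) / 2 - Real.log 2 * E.done X (t + 1) k ω) ∂P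
      ≤ ∫ ω, Z ω ∂P := by
  set Y : Ω → ℝ := fun ω => Z ω * Real.exp (F k (X (t + 1) ω k) / 2) with hY
  have hYm : Measurable[E.past t] Y := hZ.mul (Real.measurable_exp.comp (hFX.div_const 2))
  have hF01 : ∀ ω, F k (X (t + 1) ω k) ∈ Icc (0 : ℝ) 1 := fun ω => hF.mapsTo k (hX01 ω)
  have hY0 : ∀ ω, 0 ≤ Y ω := fun ω => mul_nonneg (hZ0 ω) (Real.exp_pos _).le
  have hYc : ∀ ω, |Y ω| ≤ c * Real.exp 1 := fun ω => by
    rw [abs_of_nonneg (hY0 ω)]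
    exact mul_le_mul (hc ω) (Real.exp_le_exp.2 (by linarith [(hF01 ω).2])) (Real.exp_pos _).le
      ((hZ0 ω).trans (hc ω))
  have hYm' := hYm.mono (E.past_le t) le_rfl
  have hYi : Integrable Y P := integrable_of_forall_abs_le hYm' hYc
  have hYb : ∀ {q : Ω → ℝ}, Measurable q → (∀ ω, q ω ∈ Icc (0 : ℝ) 1) →
      Integrable (fun ω => Y ω * q ω) P := fun {q} hq h01 =>
    integrable_of_forall_abs_le (hYm'.mul hq) (c := c * Real.exp 1) fun ω => by
      rw [abs_mul, abs_of_nonneg (h01 ω).1]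
      exact (mul_le_of_le_one_right (abs_nonneg _) (h01 ω).2).trans (hYc ω)
  have hdone : Integrable (fun ω => Y ω * E.done X (t + 1) k ω) P :=
    hYb ((E.measurable_done k le_rfl (hX.mono (E.past_mono t.le_succ) le_rfl)).mono
          (E.past_le _) le_rfl) (E.done_mem _ k)
  have hFi : Integrable (fun ω => Y ω * F k (X (t + 1) ω k)) P :=
    hYb (hFX.mono (E.past_le _) le_rfl) hF01
  -- A completion is `0` or `1`, so the factor `exp (-log 2 * done)` is exactly `1 - done / 2`.
  -- After averaging, what remains is `1 - p / 2 ≤ exp (-p / 2)`.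
  have h1 : ∀ ω, Z ω * Real.exp (F k (X (t + 1) ω k) / 2 - Real.log 2 * E.done X (t + 1) k ω)
      = Y ω - 1 / 2 * (Y ω * E.done X (t + 1) k ω) := by
    intro ω
    rw [Real.exp_sub, hY]
    rcases E.B_eq_zero_or_one (t + 1) k (X (t + 1) ω k) ω with h | h
    · simp [done, h]
    · simp only [done, h, mul_one]
      rw [Real.exp_log two_pos]
      ring
  calc ∫ ω, Z ω * Real.exp (F k (X (t + 1) ω k) / 2 - Real.log 2 * E.done X (t + 1) k ω) ∂P
      = ∫ ω, Y ω ∂P - 1 / 2 * ∫ ω, Y ω * E.done X (t + 1) k ω ∂P := by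
        simp_rw [h1]
        rw [integral_sub hYi (hdone.const_mul _), integral_const_mul]
    _ = ∫ ω, (Y ω - 1 / 2 * (Y ω * F k (X (t + 1) ω k))) ∂P := by
        rw [E.integral_mul_done k hX hX01 hYm hYc, integral_sub hYi (hFi.const_mul _),
          integral_const_mul]
    _ ≤ ∫ ω, Z ω ∂P := by
        refine integral_mono (hYi.sub (hFi.const_mul _)) (integrable_of_forall_abs_le
          (hZ.mono (E.past_le _) le_rfl) fun ω => (abs_of_nonneg (hZ0 ω)).trans_le (hc ω))
          fun ω => ?_
        have h2 : 1 - F k (X (t + 1) ω k) / 2 ≤ Real.exp (-(F k (X (t + 1) ω k) / 2)) :=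
          Real.one_sub_le_exp_neg _
        rw [Real.exp_neg, ← one_div, le_div_iff₀ (Real.exp_pos _)] at h2
        have h3 : Y ω - 1 / 2 * (Y ω * F k (X (t + 1) ω k))
            = Z ω * ((1 - F k (X (t + 1) ω k) / 2) * Real.exp (F k (X (t + 1) ω k) / 2)) := by
          rw [hY]; ring
        exact h3.trans_le (mul_le_of_le_one_right (hZ0 ω) h2)

/-- Hoeffding's lemma for a variable in `[0,1]`. -/
theorem integral_exp_reward_le (E : Environment P F μ) (t : ℕ) (k : Fin K) (r : ℝ) :
    ∫ ω, Real.exp (r * (E.G t ω k - μ k) - r ^ 2 / 8) ∂P ≤ 1 := by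
  have h := (hasSubgaussianMGF_of_mem_Icc (μ := P) (X := fun ω => E.G t ω k) (a := 0) (b := 1)
    ((measurable_pi_apply k).comp (E.measurable_G t)).aemeasurable
    (ae_of_all _ fun ω => E.G_mem t ω k)).mgf_le r
  rw [mgf, E.G_mean t k] at h
  simp_rw [Real.exp_sub, div_eq_mul_inv]
  rw [integral_mul_const, ← div_eq_mul_inv, div_le_one (Real.exp_pos _)]
  refine h.trans_eq ?_
  congr 1
  simp
  ring

/-- The exponential supermartingale of the rewards. -/
theorem integral_mul_exp_reward_le (E : Environment P F μ) {t : ℕ} (k : Fin K) (r : ℝ)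
    {Z C : Ω → ℝ} (hZ : Measurable[E.past t ⊔ E.noise (t + 1)] Z)
    (hC : Measurable[E.past t ⊔ E.noise (t + 1)] C) (hC01 : ∀ ω, C ω = 0 ∨ C ω = 1)
    (hZ0 : ∀ ω, 0 ≤ Z ω) {c : ℝ} (hc : ∀ ω, Z ω ≤ c) :
    ∫ ω, Z ω * Real.exp (C ω * (r * (E.G (t + 1) ω k - μ k) - r ^ 2 / 8)) ∂P
      ≤ ∫ ω, Z ω ∂P := by
  have hle : E.past t ⊔ E.noise (t + 1) ≤ mΩ := sup_le (E.past_le t) (E.noise_le _)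
  set e : (Fin K → ℝ) → ℝ := fun g => Real.exp (r * (g k - μ k) - r ^ 2 / 8) with he
  have hem : Measurable e := by fun_prop
  have hZC : Measurable[E.past t ⊔ E.noise (t + 1)] fun ω => Z ω * C ω := hZ.mul hC
  have hind : IndepFun (fun ω => Z ω * C ω) (E.G (t + 1)) P := by
    rw [IndepFun_iff_Indep]
    exact indep_of_indep_of_le_left (E.indep_past_sup_noise_G t) hZC.comap_le
  have hprod := hind.integral_fun_comp_mul_comp (f := id) (g := e)
    (hZC.mono hle le_rfl).aemeasurable (E.measurable_G (t + 1)).aemeasurable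
    measurable_id.aestronglyMeasurable hem.aestronglyMeasurable
  simp only [id] at hprod
  have hZC0 : ∀ ω, 0 ≤ Z ω * C ω := fun ω => by
    rcases hC01 ω with h | h <;> simp [h, hZ0 ω]
  have hZi : Integrable Z P := integrable_of_forall_abs_le (hZ.mono hle le_rfl) fun ω =>
    (abs_of_nonneg (hZ0 ω)).trans_le (hc ω)
  have hZCi : Integrable (fun ω => Z ω * C ω) P :=
    integrable_of_forall_abs_le (hZC.mono hle le_rfl) (c := c) fun ω => by
      rw [abs_of_nonneg (hZC0 ω)]
      rcases hC01 ω with h | h <;> simp [h, hc ω, (hZ0 ω).trans (hc ω)]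
  have hebd : ∀ ω, e (E.G (t + 1) ω) ≤ Real.exp (|r| * (1 + |μ k|)) := fun ω => by
    refine Real.exp_le_exp.2 ?_
    have h1 := (le_abs_self _).trans (abs_mul r (E.G (t + 1) ω k - μ k)).le
    have h2 : |E.G (t + 1) ω k - μ k| ≤ 1 + |μ k| := by
      refine (abs_sub _ _).trans ?_
      rw [abs_of_nonneg (E.G_mem (t + 1) ω k).1]
      linarith [(E.G_mem (t + 1) ω k).2]
    have h3 := mul_le_mul_of_nonneg_left h2 (abs_nonneg r)
    nlinarith [sq_nonneg r]
  have hZCei : Integrable (fun ω => Z ω * C ω * e (E.G (t + 1) ω)) P :=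
    integrable_of_forall_abs_le ((hZC.mono hle le_rfl).mul (hem.comp (E.measurable_G _)))
      (c := c * Real.exp (|r| * (1 + |μ k|))) fun ω => by
        rw [abs_of_nonneg (mul_nonneg (hZC0 ω) (Real.exp_pos _).le)]
        refine mul_le_mul ?_ (hebd ω) (Real.exp_pos _).le ((hZ0 ω).trans (hc ω))
        rcases hC01 ω with h | h <;> simp [h, hc ω, (hZ0 ω).trans (hc ω)]
  -- For `C` equal to `0` or `1`, `exp (C * D) = 1 - C + C * exp D`; the last term factors by
  -- independence.
  have h1 : ∀ ω, Z ω * Real.exp (C ω * (r * (E.G (t + 1) ω k - μ k) - r ^ 2 / 8))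
      = (Z ω - Z ω * C ω) + Z ω * C ω * e (E.G (t + 1) ω) := fun ω => by
    rcases hC01 ω with h | h <;> simp [h, he]
  simp_rw [h1]
  rw [integral_add (f := fun ω => Z ω - Z ω * C ω) (hZi.sub hZCi) hZCei,
    integral_sub hZi hZCi, hprod]
  have h2 := mul_le_mul_of_nonneg_left (E.integral_exp_reward_le (t + 1) k r)
    (integral_nonneg (μ := P) hZC0)
  simp only [he]
  linarith

end Environment

/-! ### Completion counts and stopping -/

section Counting

theorem exists_nat_sum_eq {d : ℕ → ℝ} (hd : ∀ s, d s = 0 ∨ d s = 1) (t : ℕ) :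
    ∃ n : ℕ, n ≤ t ∧ ∑ s ∈ Finset.range t, d s = n := by
  induction t with
  | zero => exact ⟨0, le_rfl, by simp⟩
  | succ t ih =>
    obtain ⟨n, hn, h⟩ := ih
    rcases hd t with h0 | h0
    · exact ⟨n, by omega, by rw [Finset.sum_range_succ, h, h0, add_zero]⟩
    · exact ⟨n + 1, by omega, by rw [Finset.sum_range_succ, h, h0]; push_cast; rfl⟩

/-- Stopping after the first `n` completions. -/
theorem sum_stopped_eq {d : ℕ → ℝ} (hd : ∀ s, 0 ≤ d s) (c : ℕ → ℝ) {t T : ℕ} (htT : t ≤ T)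
    {n : ℝ} (hn : ∑ s ∈ Finset.range t, d s = n) :
    ∑ s ∈ Finset.range T, (if ∑ j ∈ Finset.range s, d j < n then d s else 0) * c s
      = ∑ s ∈ Finset.range t, d s * c s := by
  have hmono : Monotone fun s => ∑ j ∈ Finset.range s, d j := fun a b hab =>
    Finset.sum_le_sum_of_subset_of_nonneg (Finset.range_mono hab) fun i _ _ => hd i
  symm
  rw [← Finset.sum_subset (Finset.range_mono htT)]
  · refine Finset.sum_congr rfl fun s hs => ?_
    split_ifs with h
    · rfl
    · have h1 : ∑ j ∈ Finset.range (s + 1), d j ≤ ∑ j ∈ Finset.range t, d j :=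
        hmono (Finset.mem_range.1 hs)
      rw [Finset.sum_range_succ] at h1
      have : d s = 0 := le_antisymm (by linarith) (hd s)
      rw [this]
  · intro s _ hs
    have h1 : ∑ j ∈ Finset.range t, d j ≤ ∑ j ∈ Finset.range s, d j :=
      hmono (not_lt.1 fun h => hs (Finset.mem_range.2 h))
    rw [if_neg (by linarith), zero_mul]

end Counting

/-- Extending the curve by constants outside `[0,1]` makes it monotone on `ℝ`, hence Borel. -/
theorem IsCurveFamily.measurable_comp {K : ℕ} {F : Fin K → ℝ → ℝ} (hF : IsCurveFamily F)
    (k : Fin K) {Ω : Type*} {m : MeasurableSpace Ω} {Y : Ω → ℝ} (hY : Measurable Y)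
    (hY01 : ∀ ω, Y ω ∈ Icc (0 : ℝ) 1) : Measurable fun ω => F k (Y ω) := by
  have hmono : Monotone (IccExtend (zero_le_one (α := ℝ)) fun x => F k x) :=
    Monotone.IccExtend _ fun x y hxy => hF.monotoneOn k x.2 y.2 hxy
  have : (fun ω => F k (Y ω)) =
      (IccExtend (zero_le_one (α := ℝ)) fun x => F k x) ∘ Y := by
    ext ω
    exact (IccExtend_of_mem _ (fun x : Icc (0 : ℝ) 1 => F k x) (hY01 ω)).symm
  rw [this]
  exact hmono.measurable.comp hY

theorem measurable_ite_lt_const {Ω : Type*} {m : MeasurableSpace Ω} {f g : Ω → ℝ}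
    (hf : Measurable f) (hg : Measurable g) (c : ℝ) :
    Measurable fun ω => if f ω < c then g ω else 0 :=
  Measurable.ite (measurableSet_lt hf measurable_const) hg measurable_const

/-! ### Concentration of rewards and completion counts -/

namespace Environment

variable {Ω : Type*} [mΩ : MeasurableSpace Ω] {P : Measure Ω} {K : ℕ}
  {F : Fin K → ℝ → ℝ} {μ : Fin K → ℝ} [IsProbabilityMeasure P] {X : ℕ → Ω → Fin K → ℝ} {T : ℕ}

/-- The number of completions is random, while the best tilt `r` depends on it. Retaining only the
first `n` completions fixes the sample size; the indicator is known before the reward is revealed.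
-/
theorem measureReal_stopped_reward_le (E : Environment P F μ)
    (hX : ∀ t < T, Measurable[E.history X t] (X (t + 1))) (k : Fin K) (n r b : ℝ) :
    P.real {ω | b ≤ ∑ s ∈ Finset.range T,
      (if ∑ j ∈ Finset.range s, E.done X (j + 1) k ω < n then E.done X (s + 1) k ω else 0)
        * (r * (E.G (s + 1) ω k - μ k) - r ^ 2 / 8)} ≤ Real.exp (-b) := by
  have hC01 : ∀ s ω, (if ∑ j ∈ Finset.range s, E.done X (j + 1) k ω < n
      then E.done X (s + 1) k ω else 0) = 0 ∨ (if ∑ j ∈ Finset.range s, E.done X (j + 1) k ω < n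
      then E.done X (s + 1) k ω else 0) = 1 := by
    intro s ω
    split_ifs
    · exact E.B_eq_zero_or_one _ _ _ _
    · exact Or.inl rfl
  have hC : ∀ s < T, Measurable[E.past s ⊔ E.noise (s + 1)] fun ω =>
      if ∑ j ∈ Finset.range s, E.done X (j + 1) k ω < n then E.done X (s + 1) k ω else 0 := by
    intro s hs
    refine measurable_ite_lt_const (m := E.past s ⊔ E.noise (s + 1))
      (Finset.measurable_fun_sum _ fun j hj => ?_) ?_ n
    · have hj := Finset.mem_range.1 hj
      exact (E.measurable_done_past hX (hj.trans hs) k).mono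
        ((E.past_mono hj).trans le_sup_left) le_rfl
    · exact measurable_apply_of_le (E.measurable_B (s + 1) k) le_sup_right
        ((measurable_pi_apply k).comp ((E.measurable_allocation hX hs).mono le_sup_left le_rfl))
  refine measureReal_le_sum_le (m := E.past) (c := |r| * (1 + |μ k|) + r ^ 2 / 8) E.past_le
    E.past_mono (fun s hs => ?_) (fun s _ ω => ?_) (fun s hs Z hZ hZ0 hZc => ?_) b
  · have hG : Measurable[E.past (s + 1)] fun ω => E.G (s + 1) ω k :=
      (measurable_pi_apply k).comp (E.measurable_G_past (s + 1))
    exact ((hC s hs).mono (sup_le (E.past_mono s.le_succ) (E.noise_le_past _)) le_rfl).mul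
      (((hG.sub_const _).const_mul _).sub_const _)
  · have h2 : |E.G (s + 1) ω k - μ k| ≤ 1 + |μ k| := by
      refine (abs_sub _ _).trans ?_
      rw [abs_of_nonneg (E.G_mem (s + 1) ω k).1]
      linarith [(E.G_mem (s + 1) ω k).2]
    have h3 := mul_le_mul_of_nonneg_left h2 (abs_nonneg r)
    have h4 : |r * (E.G (s + 1) ω k - μ k) - r ^ 2 / 8| ≤ |r| * (1 + |μ k|) + r ^ 2 / 8 := by
      refine (abs_sub _ _).trans ?_
      rw [abs_mul, abs_of_nonneg (by positivity : (0 : ℝ) ≤ r ^ 2 / 8)]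
      linarith
    rcases hC01 s ω with h | h
    · rw [h, zero_mul, abs_zero]; exact (abs_nonneg _).trans h4
    · rw [h, one_mul]; exact h4
  · obtain ⟨c, hc⟩ := hZc
    exact E.integral_mul_exp_reward_le k r (hZ.mono le_sup_left le_rfl) (hC s hs) (hC01 s) hZ0 hc

/-- The confidence intervals are valid with high probability. -/
theorem measureReal_confidence_le (E : Environment P F μ) (hμ : ∀ k, μ k ∈ Ioc (0 : ℝ) 1)
    (hX : ∀ t < T, Measurable[E.history X t] (X (t + 1))) {δ : ℝ} (hδ : 0 < δ)
    (hl : 1 ≤ Real.log (2 / δ)) :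
    P.real {ω | ∃ t < T, ∃ k, √(Real.log (2 / δ) / (1 + ∑ s ∈ Finset.Icc 1 t, E.done X s k ω))
      < |(∑ s ∈ Finset.Icc 1 t, E.gain X s k ω) / (∑ s ∈ Finset.Icc 1 t, E.done X s k ω) - μ k|}
      ≤ K * T * δ := by
  set l := Real.log (2 / δ) with hl_def
  set ε : ℕ → ℝ := fun n => √(l / (1 + (n + 1 : ℕ))) with hε
  set A : Fin K → ℕ → ℝ → Set Ω := fun k n r => {ω | 2 * (n + 1 : ℕ) * ε n ^ 2 ≤
    ∑ s ∈ Finset.range T, (if ∑ j ∈ Finset.range s, E.done X (j + 1) k ω < (n + 1 : ℕ)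
      then E.done X (s + 1) k ω else 0) * (r * (E.G (s + 1) ω k - μ k) - r ^ 2 / 8)} with hA
  have hε2 : ∀ n, ε n ^ 2 = l / (1 + (n + 1 : ℕ)) := fun n => Real.sq_sqrt (by positivity)
  have hAle : ∀ k n r, P.real (A k n r) ≤ δ / 2 := by
    intro k n r
    refine (E.measureReal_stopped_reward_le hX k _ r _).trans ?_
    -- With `m = n + 1 ≥ 1` completions the exponent is `2ml / (m + 1) ≥ l`; this is where the `1 +`
    -- under the square root is paid for.
    have h1 : l ≤ 2 * (n + 1 : ℕ) * ε n ^ 2 := by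
      rw [hε2, mul_div_assoc', le_div_iff₀ (by positivity)]
      push_cast
      have : 0 ≤ l * n := by positivity
      nlinarith
    refine (Real.exp_le_exp.2 (neg_le_neg h1)).trans ?_
    rw [Real.exp_neg, hl_def, Real.exp_log (by positivity), inv_div]
  have hsub : {ω | ∃ t < T, ∃ k, √(l / (1 + ∑ s ∈ Finset.Icc 1 t, E.done X s k ω))
      < |(∑ s ∈ Finset.Icc 1 t, E.gain X s k ω) / (∑ s ∈ Finset.Icc 1 t, E.done X s k ω) - μ k|}
      ⊆ ⋃ k ∈ (Finset.univ : Finset (Fin K)), ⋃ n ∈ Finset.range T,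
        (A k n (4 * ε n) ∪ A k n (-(4 * ε n))) := by
    rintro ω ⟨t, ht, k, hlt⟩
    rw [sum_Icc_one_eq_sum_range, sum_Icc_one_eq_sum_range] at hlt
    set d : ℕ → ℝ := fun s => E.done X (s + 1) k ω with hd
    have hd01 : ∀ s, d s = 0 ∨ d s = 1 := fun s => E.B_eq_zero_or_one _ _ _ _
    have hd0 : ∀ s, 0 ≤ d s := fun s => (E.done_mem _ k ω).1
    obtain ⟨m, hm, hsum⟩ := exists_nat_sum_eq hd01 t
    have hsum' : ∑ s ∈ Finset.range t, E.done X (s + 1) k ω = m := hsum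
    rw [hsum'] at hlt
    -- Without completions the estimate is `0 / 0 = 0`, its error `μ k ≤ 1 ≤ √l`, and the interval
    -- never fails.
    rcases m with _ | n
    · simp only [Nat.cast_zero, add_zero, div_one, div_zero, zero_sub, abs_neg] at hlt
      rw [abs_of_pos (hμ k).1] at hlt
      have : 1 ≤ √l := Real.one_le_sqrt.2 hl
      linarith [(hμ k).2]
    have hgain : ∀ r : ℝ, ∑ s ∈ Finset.range T,
        (if ∑ j ∈ Finset.range s, E.done X (j + 1) k ω < (n + 1 : ℕ)
          then E.done X (s + 1) k ω else 0) * (r * (E.G (s + 1) ω k - μ k) - r ^ 2 / 8)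
        = r * (∑ s ∈ Finset.range t, E.gain X (s + 1) k ω - (n + 1 : ℕ) * μ k)
          - (n + 1 : ℕ) * (r ^ 2 / 8) := by
      intro r
      rw [sum_stopped_eq hd0 (fun s => r * (E.G (s + 1) ω k - μ k) - r ^ 2 / 8) ht.le hsum,
        ← hsum, Finset.sum_mul, Finset.sum_mul, ← Finset.sum_sub_distrib, Finset.mul_sum,
        ← Finset.sum_sub_distrib]
      refine Finset.sum_congr rfl fun s _ => ?_
      simp only [gain, hd]
      ring
    have hn0 : (0 : ℝ) < (n + 1 : ℕ) := by positivity
    have hεn : ε n < |(∑ s ∈ Finset.range t, E.gain X (s + 1) k ω) / (n + 1 : ℕ) - μ k| := hlt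
    have hε0 : 0 ≤ ε n := Real.sqrt_nonneg _
    simp only [mem_iUnion, Finset.mem_range, Finset.mem_univ, exists_prop, true_and]
    refine ⟨k, n, by omega, ?_⟩
    -- The tilts `±4ε` maximize `|r|mε - mr²/8`, with value `2mε²`; one handles each sign of the
    -- deviation.
    rcases lt_abs.1 hεn with h | h
    · left
      simp only [hA, mem_ofPred_eq, hgain]
      rw [lt_sub_iff_add_lt, lt_div_iff₀ hn0] at h
      nlinarith [mul_le_mul_of_nonneg_left h.le hε0]
    · right
      simp only [hA, mem_ofPred_eq, hgain]
      rw [neg_sub, lt_sub_comm, div_lt_iff₀ hn0] at h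
      nlinarith [mul_le_mul_of_nonneg_left h.le hε0]
  calc _ ≤ P.real (⋃ k ∈ (Finset.univ : Finset (Fin K)), ⋃ n ∈ Finset.range T,
        (A k n (4 * ε n) ∪ A k n (-(4 * ε n)))) := measureReal_mono hsub (measure_ne_top _ _)
    _ ≤ ∑ _k : Fin K, ∑ _n ∈ Finset.range T, δ := by
        refine (measureReal_biUnion_finset_le _ _).trans (Finset.sum_le_sum fun k _ => ?_)
        refine (measureReal_biUnion_finset_le _ _).trans (Finset.sum_le_sum fun n _ => ?_)
        refine (measureReal_union_le _ _).trans ?_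
        linarith [hAle k n (4 * ε n), hAle k n (-(4 * ε n))]
    _ = K * T * δ := by simp [mul_assoc]

/-- With high probability the completion counts are at least half the expected ones, once these
are large. -/
theorem measureReal_completion_le (E : Environment P F μ) (hF : IsCurveFamily F)
    (hX : ∀ t < T, Measurable[E.history X t] (X (t + 1)))
    (hX01 : ∀ t < T, ∀ ω k, X (t + 1) ω k ∈ Icc (0 : ℝ) 1) (hT : 1 ≤ Real.log T) :
    P.real {ω | ∃ t < T, ∃ k,
      400 * Real.log T ^ 2 ≤ ∑ s ∈ Finset.range t, F k (X (s + 1) ω k) ∧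
        ∑ s ∈ Finset.Icc 1 t, E.done X s k ω
          < (∑ s ∈ Finset.range t, F k (X (s + 1) ω k)) / 2} ≤ K / T := by
  have hT0 : (0 : ℝ) < T := by
    rcases Nat.eq_zero_or_pos T with rfl | h
    · simp at hT; linarith
    · exact_mod_cast h
  set A : Fin K → ℕ → Set Ω := fun k t => {ω | 2 * Real.log T ≤ ∑ s ∈ Finset.range t,
    (F k (X (s + 1) ω k) / 2 - Real.log 2 * E.done X (s + 1) k ω)} with hA
  have hlog2 : 0 < Real.log 2 ∧ Real.log 2 < 0.7 := ⟨by positivity, by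
    linarith [Real.log_two_lt_d9]⟩
  have hAle : ∀ k, ∀ t ∈ Finset.range T, P.real (A k t) ≤ 1 / (T : ℝ) ^ 2 := by
    intro k t ht
    have ht := Finset.mem_range.1 ht
    have hFX : ∀ s < t, Measurable[E.past s] fun ω => F k (X (s + 1) ω k) := fun s hs =>
      hF.measurable_comp k (m := E.past s) ((measurable_pi_apply k).comp
        (E.measurable_allocation hX (hs.trans ht))) fun ω => hX01 s (hs.trans ht) ω k
    refine (measureReal_le_sum_le (m := E.past) (c := 2) E.past_le
      E.past_mono (fun s hs => ?_) (fun s hs ω => ?_) (fun s hs Z hZ hZ0 hZc => ?_) _).trans_eq ?_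
    · exact (((hFX s hs).mono (E.past_mono s.le_succ) le_rfl).div_const 2).sub
        ((E.measurable_done_past hX (hs.trans ht) k).const_mul _)
    · have h1 := hF.mapsTo k (hX01 s (hs.trans ht) ω k)
      have h2 := E.done_mem (X := X) (s + 1) k ω
      rw [abs_le]
      constructor <;> nlinarith [h1.1, h1.2, h2.1, h2.2, hlog2.1, hlog2.2]
    · obtain ⟨c, hc⟩ := hZc
      exact E.integral_mul_exp_done_le hF k (E.measurable_allocation hX (hs.trans ht))
        (fun ω => hX01 s (hs.trans ht) ω k) (hFX s hs) hZ hZ0 hc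
    · rw [Real.exp_neg, two_mul, Real.exp_add, Real.exp_log hT0, one_div, sq]
  have hsub : {ω | ∃ t < T, ∃ k,
      400 * Real.log T ^ 2 ≤ ∑ s ∈ Finset.range t, F k (X (s + 1) ω k) ∧
        ∑ s ∈ Finset.Icc 1 t, E.done X s k ω
          < (∑ s ∈ Finset.range t, F k (X (s + 1) ω k)) / 2}
      ⊆ ⋃ k ∈ (Finset.univ : Finset (Fin K)), ⋃ t ∈ Finset.range T, A k t := by
    rintro ω ⟨t, ht, k, h1, h2⟩
    rw [sum_Icc_one_eq_sum_range] at h2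
    simp only [mem_iUnion, Finset.mem_range, Finset.mem_univ, exists_prop, true_and]
    refine ⟨k, t, ht, ?_⟩
    simp only [hA, mem_ofPred_eq]
    rw [Finset.sum_sub_distrib, ← Finset.sum_div, ← Finset.mul_sum]
    -- The sum exceeds `(1 - log 2) / 2` times the expected count, hence `0.15 * 400 * log T ^ 2`,
    -- which is more than `2 * log T`.
    nlinarith [mul_lt_mul_of_pos_left h2 hlog2.1]
  calc _ ≤ P.real (⋃ k ∈ (Finset.univ : Finset (Fin K)), ⋃ t ∈ Finset.range T, A k t) :=
        measureReal_mono hsub (measure_ne_top _ _)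
    _ ≤ ∑ _k : Fin K, ∑ _t ∈ Finset.range T, 1 / (T : ℝ) ^ 2 := by
        refine (measureReal_biUnion_finset_le _ _).trans (Finset.sum_le_sum fun k _ => ?_)
        exact (measureReal_biUnion_finset_le _ _).trans (Finset.sum_le_sum (hAle k))
    _ = K / T := by
        simp only [Finset.sum_const, Finset.card_univ, Fintype.card_fin, Finset.card_range,
          nsmul_eq_mul]
        field_simp

variable {α : ℝ → ℝ} {M : ℝ → ℝ≥0} {δ : ℝ}

/-- The realized regret exceeds the bound with small probability. -/
theorem IsUCBRun.measureReal_lt_realizedRegret_le {E : Environment P F μ}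
    (hX : E.IsUCBRun T δ X) (hF : IsCurveFamily F) (hα : DiminishingReturns F α)
    (hM : IsLipschitzModulus F M) (hK : 1 ≤ K) (hμ : ∀ k, μ k ∈ Ioc (0 : ℝ) 1)
    (hT : 1 ≤ Real.log T) (hδ : 0 < δ) (hl : 1 ≤ Real.log (2 / δ))
    (hl' : Real.log (2 / δ) ≤ 50 * Real.log T ^ 2) {xs : Fin K → ℝ} (hxs : IsOptimal F μ xs)
    {c : ℝ} (hc : 0 ≤ c) :
    P.real {ω | regretBound F α M μ T δ c < realizedRegret F μ X T xs ω}
      ≤ K * T * δ + K / T := by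
  have hX01 : ∀ t < T, ∀ ω k, X (t + 1) ω k ∈ Icc (0 : ℝ) 1 := fun t ht ω k =>
    stdSimplex_mem_Icc (hX.isOptimal t ht ω).1 k
  refine le_trans (measureReal_mono ?_) ((measureReal_union_le _ _).trans (add_le_add
    (E.measureReal_confidence_le hμ hX.adapted hδ hl)
    (E.measureReal_completion_le hF hX.adapted hX01 hT)))
  intro ω hω
  by_contra hgood
  simp only [mem_union, mem_ofPred_eq, not_or, not_exists, not_and, not_lt] at hgood
  obtain ⟨hconf, hcomp⟩ := hgood
  rw [mem_ofPred_eq] at hω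
  refine absurd hω (not_lt.2 ?_)
  refine le_trans ?_ (sum_regret_bound_le_regretBound hF hα hK hμ hT (by linarith) hc)
  -- The level is `a = 400 * log T ^ 2`; `hl'` supplies `4 * log (2 / δ) ≤ 1 + a / 2`.
  refine sum_regret_le hF hα hM hK hμ (x := fun t => X t ω) (U := fun t => E.ucb X δ t ω)
    (N := fun t k => ∑ s ∈ Finset.Icc 1 t, E.done X s k ω) (by linarith) (by positivity)
    (by linarith) (fun t ht => hX.isOptimal t ht ω) hxs (fun t ht k => ?_)
    (fun t k => Finset.sum_nonneg fun s _ => (E.done_mem s k ω).1) hcomp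
  have h := abs_le.1 (hconf t ht k)
  simp only [ucb]
  constructor <;> linarith [h.1, h.2]

end Environment

/-! ### Regret in expectation -/

section Expectation

variable {Ω : Type*} [mΩ : MeasurableSpace Ω] {P : Measure Ω} {K : ℕ}
  {F : Fin K → ℝ → ℝ} {μ : Fin K → ℝ} {X : ℕ → Ω → Fin K → ℝ} {T : ℕ}
  {α : ℝ → ℝ} {M : ℝ → ℝ≥0} {δ : ℝ}

theorem Environment.IsUCBRun.measurable_reward {E : Environment P F μ} (hX : E.IsUCBRun T δ X)
    (hF : IsCurveFamily F) {t : ℕ} (ht : t < T) :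
    Measurable fun ω => reward F μ (X (t + 1) ω) :=
  Finset.measurable_fun_sum _ fun k _ => (hF.measurable_comp k
    ((measurable_pi_apply k).comp ((E.measurable_allocation hX.adapted ht).mono (E.past_le _)
      le_rfl)) fun ω => stdSimplex_mem_Icc (hX.isOptimal t ht ω).1 k).const_mul _

theorem realizedRegret_eq {Ω : Type*} {K : ℕ} (F : Fin K → ℝ → ℝ) (μ : Fin K → ℝ)
    (X : ℕ → Ω → Fin K → ℝ) (T : ℕ) (xs : Fin K → ℝ) :
    realizedRegret F μ X T xs
      = fun ω => ∑ t ∈ Finset.range T, (reward F μ xs - reward F μ (X (t + 1) ω)) := by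
  ext ω
  rw [realizedRegret, sum_Icc_one_eq_sum_range]
  simp [reward, Finset.sum_sub_distrib]

theorem abs_reward_le (hF : IsCurveFamily F) (hμ : ∀ k, μ k ∈ Ioc (0 : ℝ) 1) {x : Fin K → ℝ}
    (hx : x ∈ stdSimplex ℝ (Fin K)) : |reward F μ x| ≤ K := by
  have h : ∀ k, μ k * F k (x k) ∈ Icc (0 : ℝ) 1 := fun k => by
    have h1 := hF.mapsTo k (stdSimplex_mem_Icc hx k)
    exact ⟨mul_nonneg (hμ k).1.le h1.1, mul_le_one₀ (hμ k).2 h1.1 h1.2⟩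
  rw [reward, abs_of_nonneg (Finset.sum_nonneg fun k _ => (h k).1)]
  simpa using Finset.sum_le_card_nsmul Finset.univ (fun k => μ k * F k (x k)) 1
    fun k _ => (h k).2

theorem Environment.IsUCBRun.regret_eq [IsProbabilityMeasure P] {E : Environment P F μ}
    (hX : E.IsUCBRun T δ X) (hF : IsCurveFamily F) (hμ : ∀ k, μ k ∈ Ioc (0 : ℝ) 1) {xs : Fin K → ℝ}
    (hxs : IsOptimal F μ xs) :
    regret P F μ X T = ∫ ω, realizedRegret F μ X T xs ω ∂P := by
  have hsup : sSup (reward F μ '' stdSimplex ℝ (Fin K)) = reward F μ xs :=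
    IsGreatest.csSup_eq ⟨mem_image_of_mem _ hxs.1, by rintro _ ⟨y, hy, rfl⟩; exact hxs.2 hy⟩
  have hint : ∀ t ∈ Finset.range T, Integrable (fun ω => reward F μ (X (t + 1) ω)) P :=
    fun t ht => integrable_of_forall_abs_le (hX.measurable_reward hF (Finset.mem_range.1 ht))
      fun ω => abs_reward_le hF hμ (hX.isOptimal t (Finset.mem_range.1 ht) ω).1
  have hsub : ∀ t ∈ Finset.range T,
      Integrable (fun ω => reward F μ xs - reward F μ (X (t + 1) ω)) P :=
    fun t ht => (integrable_const _).sub (hint t ht)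
  rw [regret, hsup, realizedRegret_eq, sum_Icc_one_eq_sum_range, integral_finsetSum _ hsub]
  rw [Finset.sum_congr rfl fun t ht => integral_sub (integrable_const _) (hint t ht)]
  simp

theorem Environment.IsUCBRun.realizedRegret_le {E : Environment P F μ} (hX : E.IsUCBRun T δ X)
    (hF : IsCurveFamily F) (hμ : ∀ k, μ k ∈ Ioc (0 : ℝ) 1) {xs : Fin K → ℝ}
    (hxs : IsOptimal F μ xs) (ω : Ω) :
    realizedRegret F μ X T xs ω ∈ Icc (0 : ℝ) (K * T) := by
  constructor
  · rw [realizedRegret_eq]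
    exact Finset.sum_nonneg fun t ht => sub_nonneg.2
      (hxs.2 (hX.isOptimal t (Finset.mem_range.1 ht) ω).1)
  · rw [realizedRegret, sum_Icc_one_eq_sum_range]
    refine (Finset.sum_le_card_nsmul _ _ (K : ℝ) fun t ht => sum_sub_le_card hF hμ
      (hX.isOptimal t (Finset.mem_range.1 ht) ω).1 hxs.1).trans_eq ?_
    simp [mul_comm]

theorem regretBound_eq_add (c : ℝ) :
    regretBound F α M μ T δ c = regretBound F α M μ T δ 0 + c * (K : ℝ) ^ 2 := by
  unfold regretBound
  ring

theorem regretBound_nonneg (hF : IsCurveFamily F) (hα : DiminishingReturns F α)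
    (hK : 1 ≤ K) (hμ : ∀ k, μ k ∈ Ioc (0 : ℝ) 1) (hT : 1 ≤ Real.log T)
    (hδ : 0 ≤ Real.log (2 / δ)) {c : ℝ} (hc : 0 ≤ c) : 0 ≤ regretBound F α M μ T δ c := by
  refine le_trans ?_ (sum_regret_bound_le_regretBound hF hα hK hμ hT hδ hc)
  have hu := uInf_mem hF hα hK hμ
  have h1 := iInf_curve_pos hF hα hK hu
  have h2 := hα.alpha_pos _ hu
  have h3 := (muInf_mem hK hμ).1
  positivity

theorem Environment.IsUCBRun.integral_realizedRegret_le
    [IsProbabilityMeasure P] {E : Environment P F μ}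
    (hX : E.IsUCBRun T (1 / ((K : ℝ) * T) ^ 2) X) (hF : IsCurveFamily F)
    (hα : DiminishingReturns F α) (hM : IsLipschitzModulus F M) (hK : 1 ≤ K)
    (hμ : ∀ k, μ k ∈ Ioc (0 : ℝ) 1) (hT3 : 3 ≤ T) (hT : 1 ≤ Real.log T) {xs : Fin K → ℝ}
    (hxs : IsOptimal F μ xs) :
    ∫ ω, realizedRegret F μ X T xs ω ∂P
      ≤ regretBound F α M μ T (1 / ((K : ℝ) * T) ^ 2) 5 := by
  set δ := 1 / ((K : ℝ) * T) ^ 2 with hδ_def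
  have hK1 : (1 : ℝ) ≤ K := by exact_mod_cast hK
  have hT3' : (3 : ℝ) ≤ T := by exact_mod_cast hT3
  have hKT : 3 ≤ (K : ℝ) * T := by nlinarith
  have hδ : 0 < δ := by positivity
  have h2δ : 2 / δ = 2 * ((K : ℝ) * T) ^ 2 := by rw [hδ_def]; field_simp
  have hl : 1 ≤ Real.log (2 / δ) := by
    rw [h2δ, Real.le_log_iff_exp_le (by positivity)]
    nlinarith [Real.exp_one_lt_d9]
  have hmeas : Measurable (realizedRegret F μ X T xs) := by
    rw [realizedRegret_eq]
    exact Finset.measurable_fun_sum _ fun t ht =>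
      (hX.measurable_reward hF (Finset.mem_range.1 ht)).const_sub _
  have hR := hX.realizedRegret_le hF hμ hxs
  have hRi : Integrable (realizedRegret F μ X T xs) P :=
    integrable_of_forall_abs_le hmeas fun ω => (abs_of_nonneg (hR ω).1).trans_le (hR ω).2
  -- For `K < T` the tail bound applies, because `2 / δ ≤ 2 * T ^ 4 ≤ T ^ 5`. For `K ≥ T` the
  -- trivial bound `K * T ≤ K ^ 2` is enough.
  rcases lt_or_ge K T with hlt | hge
  · have hlt' : (K : ℝ) ≤ T := by exact_mod_cast hlt.le
    have hl' : Real.log (2 / δ) ≤ 50 * Real.log T ^ 2 := by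
      have h1 : Real.log (2 / δ) ≤ Real.log ((T : ℝ) ^ 5) := by
        refine Real.log_le_log (by positivity) ?_
        rw [h2δ]
        have : ((K : ℝ) * T) ^ 2 ≤ ((T : ℝ) * T) ^ 2 := by gcongr
        nlinarith [pow_pos (by positivity : (0 : ℝ) < T) 4]
      rw [Real.log_pow] at h1
      push_cast at h1
      nlinarith
    have hbad := hX.measureReal_lt_realizedRegret_le hF hα hM hK hμ hT hδ hl hl' hxs
      (c := 3) (by norm_num)
    set b := regretBound F α M μ T δ 3 with hb
    have hb0 : 0 ≤ b := regretBound_nonneg hF hα hK hμ hT (by linarith) (by norm_num)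
    set A : Set Ω := {ω | b < realizedRegret F μ X T xs ω} with hA
    have hAm : MeasurableSet A := measurableSet_lt measurable_const hmeas
    have hpt : ∀ ω, realizedRegret F μ X T xs ω ≤ b + A.indicator (fun _ => (K : ℝ) * T) ω := by
      intro ω
      by_cases hω : ω ∈ A
      · rw [indicator_of_mem hω]
        linarith [(hR ω).2]
      · rw [indicator_of_notMem hω, add_zero]
        exact not_lt.1 hω
    have hind : Integrable (A.indicator fun _ => (K : ℝ) * T) P :=
      (integrable_const _).indicator hAm
    calc ∫ ω, realizedRegret F μ X T xs ω ∂P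
        ≤ ∫ ω, (b + A.indicator (fun _ => (K : ℝ) * T) ω) ∂P :=
          integral_mono hRi ((integrable_const _).add hind) hpt
      _ = b + P.real A * (K * T) := by
          rw [integral_add (integrable_const _) hind, integral_indicator_const _ hAm]
          simp
      _ ≤ b + (K * T * δ + K / T) * (K * T) := by gcongr
      -- With `δ = 1 / (K * T) ^ 2` the bad event costs `1 + K ^ 2 ≤ 2 * K ^ 2`, raising the
      -- coefficient from `3` to `5`.
      _ = b + (1 + (K : ℝ) ^ 2) := by
          rw [hδ_def]; field_simp
      _ ≤ regretBound F α M μ T δ 5 := by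
          rw [hb, regretBound_eq_add 3, regretBound_eq_add 5]
          nlinarith
  · have hge' : (T : ℝ) ≤ K := by exact_mod_cast hge
    calc ∫ ω, realizedRegret F μ X T xs ω ∂P ≤ ∫ _ω, (K : ℝ) * T ∂P :=
          integral_mono hRi (integrable_const _) fun ω => (hR ω).2
      _ = K * T := by simp
      _ ≤ regretBound F α M μ T δ 5 := by
          rw [regretBound_eq_add]
          have := regretBound_nonneg (M := M) (δ := δ) hF hα hK hμ hT (by linarith) le_rfl
          nlinarith

end Expectation

end BudgetBandit

/-! ### The main theorem -/

theorem mainTheorem3 {Ω : Type*} [MeasurableSpace Ω] (P : Measure Ω) [IsProbabilityMeasure P]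
    (K : ℕ) (hK : 1 ≤ K) (T : ℕ) (hT : 3 ≤ T)
    (F : Fin K → ℝ → ℝ) (hF : BudgetBandit.IsCurveFamily F)
    (α : ℝ → ℝ) (hα : BudgetBandit.DiminishingReturns F α)
    (M : ℝ → ℝ≥0) (hM : BudgetBandit.IsLipschitzModulus F M)
    (μ : Fin K → ℝ) (hμ : ∀ k, μ k ∈ Set.Ioc (0 : ℝ) 1)
    (E : BudgetBandit.Environment P F μ) :
    (∃ xs, BudgetBandit.IsOptimal F μ xs) ∧
    (∀ δ ∈ Set.Ioo (2 * Real.exp (-50 * Real.log T ^ 2)) 1,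
      ∀ X : ℕ → Ω → Fin K → ℝ, E.IsUCBRun T δ X →
      ∀ xs, BudgetBandit.IsOptimal F μ xs →
        1 - (K : ℝ) / T - K * T * δ ≤
          P.real {ω | BudgetBandit.realizedRegret F μ X T xs ω ≤
            BudgetBandit.regretBound F α M μ T δ 3}) ∧
    (∀ X : ℕ → Ω → Fin K → ℝ, E.IsUCBRun T (1 / ((K : ℝ) * T) ^ 2) X →
      (∀ xs, BudgetBandit.IsOptimal F μ xs →
        BudgetBandit.regret P F μ X T =
          ∫ ω, BudgetBandit.realizedRegret F μ X T xs ω ∂P) ∧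
      BudgetBandit.regret P F μ X T ≤
        BudgetBandit.regretBound F α M μ T (1 / ((K : ℝ) * T) ^ 2) 5) := by

  have hT3 : (3 : ℝ) ≤ T := by exact_mod_cast hT
  have hK1 : (1 : ℝ) ≤ K := by exact_mod_cast hK
  have hlogT : 1 ≤ Real.log T := by
    rw [Real.le_log_iff_exp_le (by positivity)]
    linarith [Real.exp_one_lt_d9]
  obtain ⟨x₀, hx₀⟩ := BudgetBandit.exists_isOptimal hF hα hK hμ
  refine ⟨⟨x₀, hx₀⟩, fun δ hδ X hX xs hxs => ?_, fun X hX => ⟨fun xs hxs => ?_, ?_⟩⟩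
  · have hδ0 : 0 < δ := lt_trans (by positivity) hδ.1
    -- For `δ ≥ 1 / 3` the claimed probability is nonpositive, as `K * T ≥ 3`; below `1 / 3`, `log
    -- (2 / δ) ≥ 1` as the confidence bound requires.
    rcases le_or_gt (1 / 3) δ with h3 | h3
    · refine le_trans ?_ measureReal_nonneg
      have h4 : 1 ≤ (K : ℝ) * T * δ := by
        calc (1 : ℝ) = 1 * 3 * (1 / 3) := by norm_num
          _ ≤ K * T * δ := by gcongr
      have h5 : 0 ≤ (K : ℝ) / T := by positivity
      linarith
    have hl : 1 ≤ Real.log (2 / δ) := by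
      rw [Real.le_log_iff_exp_le (by positivity), le_div_iff₀ hδ0]
      nlinarith [Real.exp_one_lt_d9, Real.exp_pos 1]
    have hl' : Real.log (2 / δ) ≤ 50 * Real.log T ^ 2 := by
      rw [Real.log_le_iff_le_exp (by positivity), div_le_iff₀ hδ0]
      have h1 := mul_lt_mul_of_pos_left hδ.1 (Real.exp_pos (50 * Real.log T ^ 2))
      rw [mul_left_comm, ← Real.exp_add] at h1
      have h2 : 50 * Real.log T ^ 2 + -50 * Real.log T ^ 2 = 0 := by ring
      rw [h2, Real.exp_zero] at h1
      linarith
    have hbad := hX.measureReal_lt_realizedRegret_le hF hα hM hK hμ hlogT hδ0 hl hl' hxs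
      (c := 3) (by norm_num)
    have hun := measureReal_union_le (μ := P)
      {ω | BudgetBandit.realizedRegret F μ X T xs ω ≤ BudgetBandit.regretBound F α M μ T δ 3}
      {ω | BudgetBandit.regretBound F α M μ T δ 3 < BudgetBandit.realizedRegret F μ X T xs ω}
    have huniv : {ω | BudgetBandit.realizedRegret F μ X T xs ω ≤
          BudgetBandit.regretBound F α M μ T δ 3} ∪
        {ω | BudgetBandit.regretBound F α M μ T δ 3 <
          BudgetBandit.realizedRegret F μ X T xs ω} = univ :=
      by
      ext ω
      simpa using le_or_gt _ _
    rw [huniv, probReal_univ] at hun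
    linarith
  · exact hX.regret_eq hF hμ hxs
  · rw [hX.regret_eq hF hμ hx₀]
    exact hX.integral_realizedRegret_le hF hα hM hK hμ hT hlogT hx₀
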